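/- All structures are finite. A hypergraph $H$ consists of a finite vertex set $V(H)$ and a set $E(H)$ of subsets of $V(H)$, called edges; it is 3-uniform if every edge has exactly three elements, and empty if $E(H)=\emptyset$. For $W\subseteq V(H)$, $H[W]$ denotes the hypergraph with vertex set $W$ whose edges are the edges of $H$ contained in $W$. A set $M\subseteq V(H)$ is a module of $H$ if for each $e\in E(H)$ with $e\cap M\neq\emptyset$ and $e\setminus M\neq\emptyset$ there is $m\in M$ such that $e\cap M=\{m\}$ and $(e\setminus\{m\})\cup\{n\}\in E(H)$ for every $n\in M$. The hypergraph $H$ is prime if it has at least three vertices and its only modules are $\emptyset$, $V(H)$ and the singletons $\{v\}$, $v\in V(H)$. A module $M$ is strong if every module $N$ with $M\cap N\neq\emptyset$ satisfies $M\subseteq N$ or $N\subseteq M$. Let $\Pi(H)$ be the set of the inclusion-maximal elements among the strong modules of $H$ different from $V(H)$; when $|V(H)|\geq 2$ it is a partition of $V(H)$ into modules. For a partition $P$ of $V(H)$ into modules, the quotient $H/P$ is the hypergraph with vertex set $P$ whose edges are the sets $\mathcal{E}\subseteq P$ with $|\mathcal{E}|\geq 2$ such that $\mathcal{E}=\{X\in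 P: X\cap e\neq\emptyset\}$ for some $e\in E(H)$. Let $\mathscr{D}_{\geq 2}(H)$ be the set of strong modules of $H$ with at least two elements, and set $$\mathscr{D}_\triangle(H)=\{X\in\mathscr{D}_{\geq 2}(H): H[X]/\Pi(H[X])\text{ is prime}\},\qquad \mathscr{D}_\circ(H)=\{X\in\mathscr{D}_{\geq 2}(H): H[X]/\Pi(H[X])\text{ is empty}\}.$$ A realization of a 3-uniform hypergraph $H$ is a tournament $T$ with vertex set $V(H)$ such that the edges of $H$ are exactly the subsets $X$ of $V(H)$ for which the subtournament $T[X]$ is isomorphic to the 3-cycle; $\mathscr{R}(H)$ denotes the set of realizations of $H$, and $H$ is realizable if $\mathscr{R}(H)\neq\emptyset$. Corollary. For every realizable 3-uniform hypergraph $H$, $$|\mathscr{R}(H)|=2^{|\mathscr{D}_\triangle(H)|}\times\prod_{X\in\mathscr{D}_\circ(H)}|\Pi(H[X])|!\,.$$ -/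

import Mathlib

namespace Hypergraph

/-- A hypergraph is `k`-uniform if each of its edges has exactly `k` elements. -/
def IsUniformOfSize {α : Type*} (H : Hypergraph α) (k : ℕ) : Prop :=
  ∀ e ∈ H.edgeSet, e.encard = k

/-- The subhypergraph `H[W]`: its vertex set is `W`, and its edges are the edges of `H`
contained in `W`. -/
def inducedOn {α : Type*} (H : Hypergraph α) (W : Set α) : Hypergraph α where
  vertexSet := W
  edgeSet := {e | e ∈ H.edgeSet ∧ e ⊆ W}
  subset_vertexSet_of_mem_edgeSet' := fun _ he => he.2

/-- A set `M` of vertices is a module of `H` if, for each edge `e` meeting both `M` and its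
complement, `e ∩ M` is a singleton `{m}`, and replacing `m` in `e` by any element of `M`
yields an edge. -/
def IsModuleSet {α : Type*} (H : Hypergraph α) (M : Set α) : Prop :=
  M ⊆ H.vertexSet ∧
    ∀ e ∈ H.edgeSet, (e ∩ M).Nonempty → (e \ M).Nonempty →
      ∃ m ∈ M, e ∩ M = {m} ∧ ∀ n ∈ M, (e \ {m}) ∪ {n} ∈ H.edgeSet

/-- A module is strong if it is comparable under inclusion to every module that it meets. -/
def IsStrongModule {α : Type*} (H : Hypergraph α) (M : Set α) : Prop :=
  H.IsModuleSet M ∧ ∀ N, H.IsModuleSet N → (M ∩ N).Nonempty → M ⊆ N ∨ N ⊆ M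

/-- `Π(H)`: the inclusion-maximal elements among the strong modules of `H` distinct from `V(H)`. -/
def maxStrongModules {α : Type*} (H : Hypergraph α) : Set (Set α) :=
  {M | Maximal (fun N => H.IsStrongModule N ∧ N ≠ H.vertexSet) M}

/-- The quotient `H/P`, where `P` is a partition of `V(H)` into modules. -/
def quotientBy {α : Type*} (H : Hypergraph α) (P : Set (Set α)) : Hypergraph (Set α) where
  vertexSet := P
  edgeSet := {F | F ⊆ P ∧ 2 ≤ F.encard ∧ ∃ e ∈ H.edgeSet, F = {X ∈ P | (X ∩ e).Nonempty}}
  subset_vertexSet_of_mem_edgeSet' := fun _ hF => hF.1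

/-- A hypergraph is prime if it has at least three vertices and all of its modules are trivial. -/
def IsPrimeHypergraph {α : Type*} (H : Hypergraph α) : Prop :=
  3 ≤ H.vertexSet.encard ∧
    ∀ M, H.IsModuleSet M → M = ∅ ∨ M = H.vertexSet ∨ ∃ v, M = {v}

/-- A hypergraph (with any set of vertices) is empty if it has no edge. -/
def HasNoEdge {α : Type*} (H : Hypergraph α) : Prop :=
  H.edgeSet = ∅

/-- `𝒟_{≥2}(H)`: the strong modules of `H` with at least two elements. -/
def strongModulesGeTwo {α : Type*} (H : Hypergraph α) : Set (Set α) :=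
  {X | H.IsStrongModule X ∧ 2 ≤ X.encard}

/-- `H[X]/Π(H[X])`. -/
def gallaiQuotient {α : Type*} (H : Hypergraph α) (X : Set α) : Hypergraph (Set α) :=
  (H.inducedOn X).quotientBy (H.inducedOn X).maxStrongModules

/-- `𝒟_△(H)`: the `X ∈ 𝒟_{≥2}(H)` such that `H[X]/Π(H[X])` is prime. -/
def primeNodes {α : Type*} (H : Hypergraph α) : Set (Set α) :=
  {X ∈ H.strongModulesGeTwo | (H.gallaiQuotient X).IsPrimeHypergraph}

/-- `𝒟_○(H)`: the `X ∈ 𝒟_{≥2}(H)` such that `H[X]/Π(H[X])` is empty. -/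
def emptyNodes {α : Type*} (H : Hypergraph α) : Set (Set α) :=
  {X ∈ H.strongModulesGeTwo | (H.gallaiQuotient X).HasNoEdge}

end Hypergraph

/-- A tournament with vertex set `vertexSet ⊆ α`: between two distinct vertices there is exactly
one arc, and there are no other arcs. -/
@[ext]
structure Tournament (α : Type*) where
  vertexSet : Set α
  Arc : α → α → Prop
  left_mem : ∀ {v w}, Arc v w → v ∈ vertexSet
  right_mem : ∀ {v w}, Arc v w → w ∈ vertexSet
  asymm : ∀ {v w}, Arc v w → ¬ Arc w v
  total : ∀ {v w}, v ∈ vertexSet → w ∈ vertexSet → v ≠ w → Arc v w ∨ Arc w v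

namespace Tournament

/-- The subtournament `T[W]` induced by the vertices of `T` in `W`. -/
def inducedOn {α : Type*} (T : Tournament α) (W : Set α) : Tournament α where
  vertexSet := T.vertexSet ∩ W
  Arc v w := T.Arc v w ∧ v ∈ W ∧ w ∈ W
  left_mem := fun h => ⟨T.left_mem h.1, h.2.1⟩
  right_mem := fun h => ⟨T.right_mem h.1, h.2.2⟩
  asymm := fun h h' => T.asymm h.1 h'.1
  total := fun hv hw hne =>
    (T.total hv.1 hw.1 hne).imp (fun h => ⟨h, hv.2, hw.2⟩) (fun h => ⟨h, hw.2, hv.2⟩)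

/-- Two tournaments are isomorphic if some bijection between their vertex sets preserves and
reflects arcs. -/
def IsIsomorphic {α β : Type*} (T : Tournament α) (T' : Tournament β) : Prop :=
  ∃ f : T.vertexSet ≃ T'.vertexSet,
    ∀ x y : T.vertexSet, T.Arc x y ↔ T'.Arc (f x) (f y)

/-- The 3-cycle `({0, 1, 2}, {01, 12, 20})`. -/
def threeCycle : Tournament (Fin 3) where
  vertexSet := Set.univ
  Arc v w := (v = 0 ∧ w = 1) ∨ (v = 1 ∧ w = 2) ∨ (v = 2 ∧ w = 0)
  left_mem := fun _ => Set.mem_univ _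
  right_mem := fun _ => Set.mem_univ _
  asymm := fun {v w} => by revert v w; decide
  total := fun {v w} _ _ => by revert v w; decide

/-- The `C₃`-structure `C₃(T)`: its edges are the sets of vertices inducing a 3-cycle in `T`. -/
def C3Structure {α : Type*} (T : Tournament α) : Hypergraph α where
  vertexSet := T.vertexSet
  edgeSet := {X | X ⊆ T.vertexSet ∧ (T.inducedOn X).IsIsomorphic threeCycle}
  subset_vertexSet_of_mem_edgeSet' := fun _ hX => hX.1

end Tournament

namespace Hypergraph

/-- `ℛ(H)`: the set of realizations of `H`, i.e. of the tournaments `T` with `C₃(T) = H`. -/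
def realizations {α : Type*} (H : Hypergraph α) : Set (Tournament α) :=
  {T | T.vertexSet = H.vertexSet ∧ T.C3Structure = H}

/-- A hypergraph is realizable if it admits a realization. -/
def IsRealizable {α : Type*} (H : Hypergraph α) : Prop :=
  H.realizations.Nonempty

end Hypergraph

/-! The count is multiplicative along the tree of strong modules. A module of a realization `T` is a
module of `H`, and a module of `H` that is not one of `T` is overlapped by a module of `T`
(`exists_isModule_overlap`). Hence a strong module of `H` is a module of every realization
(`IsStrongModule.isModule`), so `T` induces tournaments on the quotient H/Π(H) and on each block.
Conversely, realizations of the quotient and of the H[X] can be chosen independently and substituted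
into one another, because an edge of `H` lies inside one block or meets three
(`ncard_realizations_eq_mul_finprod`). The strong modules of H[X] are those of `H` inside X, so
induction on the number of vertices gives a product, over the strong modules with at least two
elements, of the number of realizations of the quotient there.

Each quotient is of one of two types (`quotient_hasNoEdge_or_isPrimeHypergraph`): empty if the
hypergraph is disconnected, prime if it is connected. Realizations of an empty hypergraph on n
vertices are linear orders, n! in number. A prime one has exactly two, a tournament and its reverse
(`eq_or_eq_dual_of_cyc_iff`). For this, suppose that two realizations agree on one arc of a 3-cycle.
They then agree on all arcs chained to it through 3-cycles, and these arcs span a module, hence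
every vertex. Any remaining disagreement would generate a nontrivial module. -/

namespace Hypergraph

/-- The triple `{a, b, c}` is an edge of `H`. -/
def Adj3 {α : Type*} (H : Hypergraph α) (a b c : α) : Prop := ({a, b, c} : Set α) ∈ H.edgeSet

/-! ### Edges and modules of 3-uniform hypergraphs -/

section Basic

variable {α : Type*} {H : Hypergraph α} {a b c : α}

theorem Adj3.rotate (h : H.Adj3 a b c) : H.Adj3 b c a := by
  have : ({b, c, a} : Set α) = {a, b, c} := by ext; simp; tauto
  unfold Adj3; rwa [this]

theorem Adj3.swap (h : H.Adj3 a b c) : H.Adj3 b a c := by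
  have : ({b, a, c} : Set α) = {a, b, c} := by ext; simp; tauto
  unfold Adj3; rwa [this]

theorem Adj3.mem (h : H.Adj3 a b c) : a ∈ H.vertexSet :=
  H.subset_vertexSet_of_mem_edgeSet' h (by simp)

theorem Adj3.ne (hu : H.IsUniformOfSize 3) (h : H.Adj3 a b c) : a ≠ b := by
  rintro rfl
  have h3 := hu _ h
  have : ({a, a, c} : Set α) = {a, c} := by simp
  rw [this] at h3
  have h2 := Set.encard_insert_le {c} a
  rw [h3, Set.encard_singleton] at h2
  norm_num at h2

theorem IsUniformOfSize.exists_eq (hu : H.IsUniformOfSize 3) {e : Set α} (he : e ∈ H.edgeSet) :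
    ∃ a b c, a ≠ b ∧ a ≠ c ∧ b ≠ c ∧ e = {a, b, c} :=
  Set.encard_eq_three.1 (hu e he)

theorem IsUniformOfSize.exists_third (hu : H.IsUniformOfSize 3) {e : Set α} (he : e ∈ H.edgeSet)
    (ha : a ∈ e) (hc : c ∈ e) (hac : a ≠ c) : ∃ b, e = {a, b, c} := by
  obtain ⟨x, y, z, hxy, hxz, hyz, rfl⟩ := hu.exists_eq he
  simp only [Set.mem_insert_iff, Set.mem_singleton_iff] at ha hc
  rcases ha with rfl | rfl | rfl <;> rcases hc with rfl | rfl | rfl <;>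
    first
    | exact absurd rfl hac
    | (refine ⟨x, ?_⟩; ext; simp; try tauto)
    | (refine ⟨y, ?_⟩; ext; simp; try tauto)
    | (refine ⟨z, ?_⟩; ext; simp; try tauto)

theorem sdiff_singleton_union_singleton (hab : a ≠ b) (hac : a ≠ c) (n : α) :
    ({a, b, c} : Set α) \ {a} ∪ {n} = {n, b, c} := by
  ext x
  simp only [Set.mem_union, Set.mem_sdiff, Set.mem_insert_iff, Set.mem_singleton_iff]
  constructor
  · tauto
  · rintro (h | rfl | rfl)
    · exact Or.inr h
    · exact Or.inl ⟨by simp, hab.symm⟩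
    · exact Or.inl ⟨by simp, hac.symm⟩

/-- In a triple with `a` inside `M` and `c` outside, the trace on `M` is a singleton exactly when
`b` is outside too, and the vertex to be exchanged is then `a`. All labellings of an edge are
covered because `Adj3` is symmetric. -/
theorem isModuleSet_iff (hu : H.IsUniformOfSize 3) {M : Set α} :
    H.IsModuleSet M ↔ M ⊆ H.vertexSet ∧ ∀ a b c, H.Adj3 a b c → a ∈ M → c ∉ M →
      b ∉ M ∧ ∀ n ∈ M, H.Adj3 n b c := by
  refine and_congr_right fun _ => ⟨fun h a b c he ha hc => ?_, fun h e he => ?_⟩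
  · obtain ⟨m, hm, hem, hs⟩ := h _ he ⟨a, by simp, ha⟩ ⟨c, by simp, hc⟩
    have ham : a = m := by
      have : a ∈ ({a, b, c} : Set α) ∩ M := ⟨by simp, ha⟩
      rwa [hem] at this
    subst ham
    have hab : a ≠ b := he.ne hu
    have hac : a ≠ c := he.rotate.rotate.ne hu |>.symm
    refine ⟨fun hb => ?_, fun n hn => ?_⟩
    · have : b ∈ ({a, b, c} : Set α) ∩ M := ⟨by simp, hb⟩
      rw [hem] at this
      exact hab this.symm
    · have := hs n hn
      rwa [sdiff_singleton_union_singleton hab hac] at this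
  · rintro ⟨a, hae, haM⟩ ⟨c, hce, hcM⟩
    have hac : a ≠ c := fun h => hcM (h ▸ haM)
    obtain ⟨b, rfl⟩ := hu.exists_third he hae hce hac
    have hab : a ≠ b := Adj3.ne hu he
    obtain ⟨hb, hn⟩ := h a b c he haM hcM
    refine ⟨a, haM, ?_, fun n hnM => ?_⟩
    · ext x
      simp only [Set.mem_inter_iff, Set.mem_insert_iff, Set.mem_singleton_iff]
      constructor
      · rintro ⟨rfl | rfl | rfl, hx⟩
        · rfl
        · exact absurd hx hb
        · exact absurd hx hcM
      · rintro rfl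
        exact ⟨by simp, haM⟩
    · rw [sdiff_singleton_union_singleton hab hac]
      exact hn n hnM

end Basic

end Hypergraph

/-! ### Tournaments, their 3-cycles and their modules -/

namespace Tournament

section Basic

variable {α : Type*} {T T' : Tournament α} {a b c : α}

/-- The vertices `a`, `b`, `c` induce a 3-cycle in `T`. -/
def Cyc (T : Tournament α) (a b c : α) : Prop :=
  (T.Arc a b ∧ T.Arc b c ∧ T.Arc c a) ∨ (T.Arc b a ∧ T.Arc c b ∧ T.Arc a c)

theorem irrefl (T : Tournament α) (a : α) : ¬ T.Arc a a := fun h => T.asymm h h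

theorem mem_edgeSet_C3Structure {X : Set α} :
    X ∈ T.C3Structure.edgeSet ↔
      ∃ a b c, X = {a, b, c} ∧ T.Arc a b ∧ T.Arc b c ∧ T.Arc c a := by
  constructor
  · rintro ⟨hX, f, hf⟩
    have key : ∀ i j : Fin 3, threeCycle.Arc i j →
        T.Arc (f.symm ⟨i, trivial⟩) (f.symm ⟨j, trivial⟩) := by
      intro i j hij
      have := (hf (f.symm ⟨i, trivial⟩) (f.symm ⟨j, trivial⟩)).2 (by simpa using hij)
      exact this.1
    refine ⟨f.symm ⟨0, trivial⟩, f.symm ⟨1, trivial⟩, f.symm ⟨2, trivial⟩, ?_,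
      key _ _ (Or.inl ⟨rfl, rfl⟩), key _ _ (Or.inr (Or.inl ⟨rfl, rfl⟩)),
      key _ _ (Or.inr (Or.inr ⟨rfl, rfl⟩))⟩
    ext x
    simp only [Set.mem_insert_iff, Set.mem_singleton_iff]
    constructor
    · intro hx
      have hx' : x ∈ (T.inducedOn X).vertexSet := ⟨hX hx, hx⟩
      obtain ⟨i, hi⟩ : ∃ i, f ⟨x, hx'⟩ = i := ⟨_, rfl⟩
      have hxi : x = f.symm i := by rw [← hi]; simp
      obtain ⟨i, hi'⟩ := i
      fin_cases i
      · exact Or.inl hxi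
      · exact Or.inr (Or.inl hxi)
      · exact Or.inr (Or.inr hxi)
    · rintro (rfl | rfl | rfl)
      · exact (f.symm ⟨0, trivial⟩).2.2
      · exact (f.symm ⟨1, trivial⟩).2.2
      · exact (f.symm ⟨2, trivial⟩).2.2
  · rintro ⟨a, b, c, rfl, hab, hbc, hca⟩
    have hsub : ({a, b, c} : Set α) ⊆ T.vertexSet := by
      rintro x (rfl | rfl | rfl)
      exacts [T.left_mem hab, T.left_mem hbc, T.left_mem hca]
    refine ⟨hsub, ?_⟩
    have hmem : ∀ i : Fin 3, ![a, b, c] i ∈ (T.inducedOn {a, b, c}).vertexSet := by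
      intro i
      have : ![a, b, c] i ∈ ({a, b, c} : Set α) := by fin_cases i <;> simp
      exact ⟨hsub this, this⟩
    have n1 : a ≠ b := fun h => T.irrefl _ (h ▸ hab)
    have n2 : b ≠ c := fun h => T.irrefl _ (h ▸ hbc)
    have n3 : c ≠ a := fun h => T.irrefl _ (h ▸ hca)
    let g : threeCycle.vertexSet → (T.inducedOn {a, b, c}).vertexSet :=
      fun i => ⟨![a, b, c] i.1, hmem i.1⟩
    have hg : Function.Bijective g := by
      constructor
      · rintro ⟨i, hi⟩ ⟨j, hj⟩ h
        have h' : ![a, b, c] i = ![a, b, c] j := congrArg Subtype.val h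
        fin_cases i <;> fin_cases j <;> simp_all
      · rintro ⟨x, hxV, hx⟩
        rcases hx with rfl | rfl | rfl
        · exact ⟨⟨0, trivial⟩, rfl⟩
        · exact ⟨⟨1, trivial⟩, rfl⟩
        · exact ⟨⟨2, trivial⟩, rfl⟩
    refine ⟨(Equiv.ofBijective g hg).symm, fun x y => ?_⟩
    obtain ⟨i, rfl⟩ := (Equiv.ofBijective g hg).surjective x
    obtain ⟨j, rfl⟩ := (Equiv.ofBijective g hg).surjective y
    rw [Equiv.symm_apply_apply, Equiv.symm_apply_apply]
    have e1 : ∀ i, ((Equiv.ofBijective g hg i : (T.inducedOn {a, b, c}).vertexSet) : α) =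
      ![a, b, c] i.1 := fun _ => rfl
    rw [e1, e1]
    have e2 : ∀ i j, (T.inducedOn {a, b, c}).Arc (![a, b, c] i) (![a, b, c] j) ↔
        T.Arc (![a, b, c] i) (![a, b, c] j) :=
      fun i j => ⟨fun h => h.1, fun h => ⟨h, (hmem i).2, (hmem j).2⟩⟩
    rw [e2]
    obtain ⟨i, hi⟩ := i
    obtain ⟨j, hj⟩ := j
    have a1 := T.asymm hab
    have a2 := T.asymm hbc
    have a3 := T.asymm hca
    have i1 := T.irrefl a
    have i2 := T.irrefl b
    have i3 := T.irrefl c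
    fin_cases i <;> fin_cases j <;> simp [threeCycle, *]

theorem cyc_iff_mem : T.Cyc a b c ↔ ({a, b, c} : Set α) ∈ T.C3Structure.edgeSet := by
  rw [mem_edgeSet_C3Structure]
  constructor
  · rintro (⟨h1, h2, h3⟩ | ⟨h1, h2, h3⟩)
    · exact ⟨a, b, c, rfl, h1, h2, h3⟩
    · exact ⟨b, a, c, by ext; simp; tauto, h1, h3, h2⟩
  · rintro ⟨x, y, z, he, h1, h2, h3⟩
    have hx : x ∈ ({a, b, c} : Set α) := by rw [he]; simp
    have hy : y ∈ ({a, b, c} : Set α) := by rw [he]; simp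
    have hz : z ∈ ({a, b, c} : Set α) := by rw [he]; simp
    have i1 := T.irrefl a
    have i2 := T.irrefl b
    have i3 := T.irrefl c
    have n12 := @T.asymm a b
    have n13 := @T.asymm a c
    have n23 := @T.asymm b c
    simp only [Set.mem_insert_iff, Set.mem_singleton_iff] at hx hy hz
    unfold Cyc
    rcases hx with rfl | rfl | rfl <;> rcases hy with rfl | rfl | rfl <;>
      rcases hz with rfl | rfl | rfl <;> tauto

theorem mem_realizations_iff {H : Hypergraph α} (hu : H.IsUniformOfSize 3) :
    T ∈ H.realizations ↔
      T.vertexSet = H.vertexSet ∧ ∀ a b c, H.Adj3 a b c ↔ T.Cyc a b c := by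
  refine and_congr_right fun hV => ⟨?_, fun h => ?_⟩
  · rintro rfl a b c
    exact cyc_iff_mem.symm
  · refine Hypergraph.ext hV (Set.ext fun e => ⟨fun he => ?_, fun he => ?_⟩)
    · obtain ⟨a, b, c, rfl, h1, h2, h3⟩ := mem_edgeSet_C3Structure.1 he
      exact (h a b c).2 (Or.inl ⟨h1, h2, h3⟩)
    · obtain ⟨a, b, c, -, -, -, rfl⟩ := hu.exists_eq he
      exact cyc_iff_mem.1 ((h a b c).1 he)

/-- `M` is a module of the tournament `T`: no vertex outside `M` distinguishes two elements
of `M`. -/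
def IsModule (T : Tournament α) (M : Set α) : Prop :=
  M ⊆ T.vertexSet ∧ ∀ x a b, x ∉ M → a ∈ M → b ∈ M → T.Arc x a → T.Arc x b

theorem IsModule.arc_left {M : Set α} (h : T.IsModule M) {x a b : α} (hx : x ∉ M) (ha : a ∈ M)
    (hb : b ∈ M) (hax : T.Arc a x) : T.Arc b x := by
  rcases T.total (h.1 hb) (T.right_mem hax) (fun hbx => hx (hbx ▸ hb)) with h' | h'
  · exact h'
  · exact absurd hax (T.asymm (h.2 x b a hx hb ha h'))

/-- An outside vertex dominates all of `M` or is dominated by all of it. So it closes no 3-cycle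
with two vertices of `M`, and in a 3-cycle with one vertex in `M` that vertex may be exchanged for
any other. -/
theorem IsModule.isModuleSet {H : Hypergraph α} (hu : H.IsUniformOfSize 3)
    (hT : T ∈ H.realizations) {M : Set α} (h : T.IsModule M) : H.IsModuleSet M := by
  obtain ⟨hV, hE⟩ := (mem_realizations_iff hu).1 hT
  refine (Hypergraph.isModuleSet_iff hu).2 ⟨hV ▸ h.1, fun a b c habc ha hc => ?_⟩
  have h1 := (hE _ _ _).1 habc
  have as := @T.asymm
  have hb : b ∉ M := by
    intro hb
    have h2 := h.2 c
    have h3 : ∀ a b, c ∉ M → a ∈ M → b ∈ M → T.Arc a c → T.Arc b c := fun a b => h.arc_left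
    unfold Cyc at h1
    grind
  refine ⟨hb, fun n hn => (hE _ _ _).2 ?_⟩
  rcases h1 with ⟨h1, h2, h3⟩ | ⟨h1, h2, h3⟩
  · exact Or.inl ⟨h.arc_left hb ha hn h1, h2, h.2 _ _ _ hc ha hn h3⟩
  · exact Or.inr ⟨h.2 _ _ _ hb ha hn h1, h2, h.arc_left hc ha hn h3⟩

/-- A module of `C₃(T)` which is not a module of `T` overlaps a module of `T`. -/
theorem exists_isModule_overlap {H : Hypergraph α} (hu : H.IsUniformOfSize 3)
    (hT : T ∈ H.realizations) {M : Set α} (hM : H.IsModuleSet M) (hTM : ¬ T.IsModule M) :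
    ∃ N, T.IsModule N ∧ (M ∩ N).Nonempty ∧ ¬ M ⊆ N ∧ ¬ N ⊆ M := by
  obtain ⟨hV, hE⟩ := (mem_realizations_iff hu).1 hT
  obtain ⟨hMV, hm⟩ := (Hypergraph.isModuleSet_iff hu).1 hM
  have as := @T.asymm
  have tot := @T.total
  have lm := @T.left_mem
  have rm := @T.right_mem
  rw [← hV] at hMV
  simp only [hE] at hm
  obtain ⟨x, b, a, hx, hb, ha, hxb, hxa⟩ :
      ∃ x b a, x ∉ M ∧ b ∈ M ∧ a ∈ M ∧ T.Arc x b ∧ ¬ T.Arc x a := by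
    unfold IsModule at hTM
    push Not at hTM
    exact hTM hMV
  have hax : T.Arc a x := by
    rcases tot (hMV ha) (lm hxb) (by rintro rfl; exact hx ha) with h | h
    · exact h
    · exact absurd h hxa
  -- The two forms of the hypothesis on `M`: no 3-cycle has exactly two vertices in `M` (`two`), and
  -- the only vertex of a 3-cycle in `M` may be exchanged, keeping the orientation, which the arc
  -- between the two outside vertices determines (`sw`).
  have two : ∀ p q z, p ∈ M → q ∈ M → z ∉ M → ¬ (T.Arc p q ∧ T.Arc q z ∧ T.Arc z p) :=
    fun p q z hp hq hz h => (hm p q z (Or.inl h) hp hz).1 hq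
  have sw : ∀ p q y z, p ∈ M → q ∈ M → y ∉ M → z ∉ M → T.Arc p y → T.Arc y z → T.Arc z p →
      T.Arc q y ∧ T.Arc z q := by
    intro p q y z hp hq hy hz h1 h2 h3
    rcases (hm p y z (Or.inl ⟨h1, h2, h3⟩) hp hz).2 q hq with h | h
    · exact ⟨h.1, h.2.2⟩
    · exact absurd h.2.1 (as h2)
  -- The vertex `x` splits `M` into a lower part (dominating `x`) and an upper part (dominated by
  -- `x`), and by `hlow` the lower part dominates the upper. `N` consists of the vertices dominated
  -- by the whole lower part that belong to `M` or dominate some element of `M`. It contains `b` and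
  -- `x` but not `a`, hence overlaps `M`.
  let N : Set α := {y | y ∈ T.vertexSet ∧ (∀ m ∈ M, T.Arc m x → T.Arc m y) ∧
    (y ∈ M ∨ ∃ m ∈ M, T.Arc y m)}
  have hlow : ∀ p ∈ M, ∀ q ∈ M, T.Arc p x → T.Arc x q → T.Arc p q := by
    intro p hp q hq h1 h2
    have hpq : p ≠ q := by rintro rfl; exact as h1 h2
    rcases tot (hMV hp) (hMV hq) hpq with h | h
    · exact h
    · exact absurd ⟨h, h1, h2⟩ (two q p x hq hp hx)
  refine ⟨N, ⟨fun y hy => hy.1, ?_⟩, ⟨b, hb, hMV hb, fun m hmM hmx => hlow m hmM b hb hmx hxb,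
    Or.inl hb⟩, fun h => T.irrefl a ((h ha).2.1 a ha hax), fun h => hx (h ⟨lm hxb,
    fun m _ hmx => hmx, Or.inr ⟨b, hb, hxb⟩⟩)⟩
  -- An outside vertex `z` dominated by the lower part is dominated by `N`; any other dominates `N`.
  -- An arc the wrong way would give a 3-cycle with two vertices in `M`, or one whose vertex in `M`
  -- can be exchanged to reverse a known arc.
  have dich : ∀ z ∈ T.vertexSet, z ∉ N → (∀ y ∈ N, T.Arc z y) ∨ (∀ y ∈ N, T.Arc y z) := by
    intro z hzV hz
    by_cases h1 : ∀ m ∈ M, T.Arc m x → T.Arc m z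
    · right
      have hzM : z ∉ M := fun h => hz ⟨hzV, h1, Or.inl h⟩
      have hMz : ∀ m ∈ M, T.Arc m z := by
        intro m hmM
        rcases tot (hMV hmM) hzV (by rintro rfl; exact hzM hmM) with h | h
        · exact h
        · exact absurd ⟨hzV, h1, Or.inr ⟨m, hmM, h⟩⟩ hz
      rintro y hy
      have hyz : y ≠ z := by rintro rfl; exact hz hy
      by_cases hyM : y ∈ M
      · exact hMz y hyM
      obtain ⟨m, hmM, hym⟩ := hy.2.2.resolve_left hyM
      rcases tot hy.1 hzV hyz with h | h
      · exact h
      · exact absurd (sw m a z y hmM ha hzM hyM (hMz m hmM) h hym).2 (as (hy.2.1 a ha hax))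
    · left
      push Not at h1
      obtain ⟨m, hmM, hmx, hmz⟩ := h1
      intro y hy
      have hyz : z ≠ y := by rintro rfl; exact hz hy
      by_cases hmz' : m = z
      · subst hmz'
        exact hy.2.1 m hmM hmx
      have hzm : T.Arc z m := (tot (hMV hmM) hzV hmz').resolve_left hmz
      have hmy := hy.2.1 m hmM hmx
      by_cases hzx : z ∈ M ∧ T.Arc z x
      · exact hy.2.1 z hzx.1 hzx.2
      have hzM : z ∉ M := by
        intro hzM
        rcases tot hzV (lm hxb) (by rintro rfl; exact hx hzM) with h | h
        · exact hzx ⟨hzM, h⟩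
        · exact hmz (hlow m hmM z hzM hmx h)
      rcases tot hzV hy.1 hyz with h | h
      · exact h
      · by_cases hyM : y ∈ M
        · exact absurd ⟨hmy, h, hzm⟩ (two m y z hmM hyM hzM)
        · obtain ⟨m0, hm0, hym0⟩ := hy.2.2.resolve_left hyM
          exact absurd (sw m m0 y z hmM hm0 hyM hzM hmy h hzm).1 (as hym0)
  intro z p q hz hp hq hzp
  rcases dich z (lm hzp) hz with h | h
  · exact h q hq
  · exact absurd hzp (as (h p hp))

end Basic

end Tournament

/-! ### Tournaments determined up to reversal by their 3-cycles -/

namespace Tournament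

section Prime

variable {α : Type*} {T T' : Tournament α} {a b : α}

/-- The reverse of a tournament. -/
def dual (T : Tournament α) : Tournament α where
  vertexSet := T.vertexSet
  Arc v w := T.Arc w v
  left_mem := T.right_mem
  right_mem := T.left_mem
  asymm := fun h h' => T.asymm h h'
  total := fun hv hw hne => T.total hw hv hne.symm

theorem cyc_dual {a b c : α} : T.dual.Cyc a b c ↔ T.Cyc a b c := by
  unfold Cyc dual; tauto

/-- The arcs reachable from the arc `a → b` by walking along 3-cycles of `T`. -/
inductive ArcClass (T : Tournament α) (a b : α) : α → α → Prop
  | base : ArcClass T a b a b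
  | step {p q r : α} : ArcClass T a b p q → T.Arc q r → T.Arc r p → ArcClass T a b q r

theorem ArcClass.exists_cycle {c : α} (hab : T.Arc a b) (hbc : T.Arc b c) (hca : T.Arc c a)
    {p q : α} (h : T.ArcClass a b p q) : T.Arc p q ∧ ∃ r, T.Arc q r ∧ T.Arc r p := by
  induction h with
  | base => exact ⟨hab, c, hbc, hca⟩
  | step h h1 h2 ih => exact ⟨h1, _, h2, ih.1⟩

/-- The span of a class of arcs containing a 3-cycle is a module. -/
theorem isModule_arcClass {c : α} (hab : T.Arc a b) (hbc : T.Arc b c) (hca : T.Arc c a) :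
    T.IsModule {p | ∃ q, T.ArcClass a b p q} := by
  have cyc := fun {p q : α} (h : T.ArcClass a b p q) => h.exists_cycle hab hbc hca
  refine ⟨fun p ⟨q, hpq⟩ => T.left_mem (cyc hpq).1, fun x p q hx => ?_⟩
  -- If `x` dominates `p` but is dominated by `q`, then q → x → p → q is a 3-cycle and `x` enters
  -- the span. Going round the 3-cycle through `p` and `q` turns this implication into an
  -- equivalence, which is then carried along the class.
  have one : ∀ p q, T.ArcClass a b p q → T.Arc x p → T.Arc x q := by
    intro p q h hxp
    have hxq : x ≠ q := by
      rintro rfl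
      obtain ⟨-, r, h1, h2⟩ := cyc h
      exact hx ⟨r, h.step h1 h2⟩
    rcases T.total (T.left_mem hxp) (T.right_mem (cyc h).1) hxq with h' | h'
    · exact h'
    · exact absurd ⟨p, (h.step h' hxp).step hxp (cyc h).1⟩ hx
  have all : ∀ p q, T.ArcClass a b p q → (T.Arc x p ↔ T.Arc x a) ∧ (T.Arc x q ↔ T.Arc x p) := by
    intro p q h
    have back : ∀ p q, T.ArcClass a b p q → (T.Arc x q ↔ T.Arc x p) := by
      intro p q h
      obtain ⟨hpq, r, h1, h2⟩ := cyc h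
      have hs := h.step h1 h2
      exact ⟨fun h' => one _ _ (hs.step h2 hpq) (one _ _ hs h'), one _ _ h⟩
    refine ⟨?_, back _ _ h⟩
    induction h with
    | base => rfl
    | step h h1 h2 ih => exact (back _ _ h).trans ih
  rintro ⟨p', hp⟩ ⟨q', hq⟩ h
  exact (all _ _ hq).1.2 ((all _ _ hp).1.1 h)

/-- The two tournaments orient the pair `x`, `y` differently. -/
def Disagree (T T' : Tournament α) (x y : α) : Prop :=
  T.Arc x y ∧ T'.Arc y x ∨ T.Arc y x ∧ T'.Arc x y

theorem Disagree.symm {x y : α} (h : Disagree T T' x y) : Disagree T T' y x := Or.symm h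

theorem Disagree.left_mem {x y : α} (h : Disagree T T' x y) : x ∈ T.vertexSet := by
  rcases h with h | h
  exacts [T.left_mem h.1, T.right_mem h.1]

theorem not_disagree_self {x : α} : ¬ Disagree T T' x x := by
  rintro (h | h) <;> exact T.irrefl _ h.1

theorem Disagree.ne_left {x y z : α} (h : Disagree T T' x y) (h1 : T.Arc z y)
    (h2 : T'.Arc z y) : x ≠ z := by
  rintro rfl
  rcases h with h | h
  exacts [T'.asymm h2 h.2, T.asymm h1 h.1]

theorem Disagree.ne_right {x y z : α} (h : Disagree T T' x y) (h1 : T.Arc y z)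
    (h2 : T'.Arc y z) : x ≠ z := by
  rintro rfl
  rcases h with h | h
  exacts [T.asymm h1 h.1, T'.asymm h2 h.2]

/-- As `p → q` is common to both tournaments, the triple `x`, `p`, `q` forces `x` to dominate both
vertices in one tournament and to be dominated by both in the other. If the pair `x`, `r` were then
oriented alike, `x`, `q`, `r` or `x`, `r`, `p` would be cyclic in only one of them. -/
theorem Disagree.of_cycle (hV : T'.vertexSet = T.vertexSet)
    (hcyc : ∀ a b c, T.Cyc a b c ↔ T'.Cyc a b c) {x p q r : α} (h1 : T.Arc p q) (h2 : T.Arc q r)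
    (h3 : T.Arc r p) (a1 : T'.Arc p q) (a2 : T'.Arc q r) (a3 : T'.Arc r p)
    (hp : Disagree T T' x p) (hq : Disagree T T' x q) : Disagree T T' x r := by
  have hxr : x ≠ r := hq.ne_right h2 a2
  have hxV := hp.left_mem
  have t1 := T.total hxV (T.left_mem h3) hxr
  have t2 := T'.total (hV ▸ hxV) (T'.left_mem a3) hxr
  have c1 := hcyc x p q
  have c2 := hcyc x q r
  have c3 := hcyc x r p
  have x1 := @T.asymm
  have x2 := @T'.asymm
  simp only [Disagree, Cyc] at *
  rcases t1 with t1 | t1 <;> rcases t2 with t2 | t2 <;> rcases hp with ⟨hp, hp'⟩ | ⟨hp, hp'⟩ <;>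
    rcases hq with ⟨hq, hq'⟩ | ⟨hq, hq'⟩ <;> simp [*] at c1 c2 c3 ⊢

/-- The triple `x`, `p`, `q` differs only in the pair `x`, `p`, so it is cyclic in neither
tournament, which forces `x → q`; likewise `r → x`. Thus `x` can replace `p` in the 3-cycle. -/
theorem Disagree.twin (hV : T'.vertexSet = T.vertexSet)
    (hcyc : ∀ a b c, T.Cyc a b c ↔ T'.Cyc a b c) {x p q r : α} (h1 : T.Arc p q) (h2 : T.Arc q r)
    (h3 : T.Arc r p) (a1 : T'.Arc p q) (a2 : T'.Arc q r) (a3 : T'.Arc r p)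
    (hp : Disagree T T' x p) (hq : ¬ Disagree T T' x q) (hr : ¬ Disagree T T' x r) :
    T.Arc x q ∧ T.Arc r x := by
  have hxr : x ≠ r := hp.ne_left h3 a3
  have hxq : x ≠ q := hp.ne_right h1 a1
  have hxV := hp.left_mem
  have t1 := T.total hxV (T.left_mem h3) hxr
  have t2 := T'.total (hV ▸ hxV) (T'.left_mem a3) hxr
  have t3 := T.total hxV (T.left_mem h2) hxq
  have t4 := T'.total (hV ▸ hxV) (T'.left_mem a2) hxq
  have c1 := hcyc x p q
  have c2 := hcyc x q r
  have c3 := hcyc x r p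
  have x1 := @T.asymm
  have x2 := @T'.asymm
  simp only [Disagree, Cyc, not_or, not_and] at *
  rcases t1 with t1 | t1 <;> rcases t2 with t2 | t2 <;> rcases t3 with t3 | t3 <;>
    rcases t4 with t4 | t4 <;> rcases hp with ⟨hp, hp'⟩ | ⟨hp, hp'⟩ <;>
    simp [*] at c1 c2 c3 hq hr ⊢

/-- If `x` separated `p` from `q`, one of the two orientations of `p`, `q` would make the triple
cyclic and the other would not. -/
theorem Disagree.arc_iff (hV : T'.vertexSet = T.vertexSet)
    (hcyc : ∀ a b c, T.Cyc a b c ↔ T'.Cyc a b c) {x p q : α} (hxp : x ≠ p) (hxq : x ≠ q)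
    (hpq : Disagree T T' p q) (hp : ¬ Disagree T T' p x) (hq : ¬ Disagree T T' q x) :
    T.Arc x p ↔ T.Arc x q := by
  by_cases hxV : x ∈ T.vertexSet
  · have hpV := hpq.left_mem
    have hqV := hpq.symm.left_mem
    have t1 := T.total hxV hpV hxp
    have t2 := T'.total (hV ▸ hxV) (hV ▸ hpV) hxp
    have t3 := T.total hxV hqV hxq
    have t4 := T'.total (hV ▸ hxV) (hV ▸ hqV) hxq
    have c1 := hcyc x p q
    have x1 := @T.asymm
    have x2 := @T'.asymm
    simp only [Disagree, Cyc, not_or, not_and] at *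
    rcases t1 with t1 | t1 <;> rcases t2 with t2 | t2 <;> rcases t3 with t3 | t3 <;>
      rcases t4 with t4 | t4 <;> rcases hpq with ⟨hpq, hpq'⟩ | ⟨hpq, hpq'⟩ <;>
      simp [*] at c1 hp hq ⊢
  · exact ⟨fun h => absurd (T.left_mem h) hxV, fun h => absurd (T.left_mem h) hxV⟩

/-- Agreement spreads along the class of `a → b`, whose span is everything by primality. It remains
to exclude disagreements on other pairs: the vertices linked to a given one by a chain of
disagreements would form a nontrivial module. -/
theorem eq_of_cyc_iff_of_agree (hV : T'.vertexSet = T.vertexSet)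
    (hcyc : ∀ a b c, T.Cyc a b c ↔ T'.Cyc a b c)
    (hprime : ∀ M, T.IsModule M → M = ∅ ∨ M = T.vertexSet ∨ ∃ v, M = {v})
    {a b c : α} (hab : T.Arc a b) (hbc : T.Arc b c) (hca : T.Arc c a) (hab' : T'.Arc a b) :
    T' = T := by
  have cyc := fun {p q : α} (h : T.ArcClass a b p q) => h.exists_cycle hab hbc hca
  have as' := @T'.asymm
  have tot := @T.total
  have tot' := @T'.total
  have lm := @T.left_mem
  have rm := @T.right_mem
  have irr := T.irrefl
  have irr' := T'.irrefl
  have lm' := fun {x y : α} (h : T'.Arc x y) => hV ▸ T'.left_mem h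
  have rm' := fun {x y : α} (h : T'.Arc x y) => hV ▸ T'.right_mem h
  rw [hV] at tot'
  have hspan : {p | ∃ q, T.ArcClass a b p q} = T.vertexSet := by
    have ha : a ∈ {p | ∃ q, T.ArcClass a b p q} := ⟨b, .base⟩
    have hb : b ∈ {p | ∃ q, T.ArcClass a b p q} := ⟨c, .step .base hbc hca⟩
    rcases hprime _ (isModule_arcClass hab hbc hca) with h | h | ⟨v, h⟩
    · rw [h] at ha; exact ha.elim
    · exact h
    · rw [h] at ha hb
      obtain rfl : a = v := ha
      obtain rfl : b = a := hb
      exact absurd hab (irr _)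
  let D := Disagree T T'
  have agree : ∀ p q, T.ArcClass a b p q → T'.Arc p q := by
    intro p q h
    induction h with
    | base => exact hab'
    | @step p q r h h1 h2 ih =>
      have := (hcyc p q r).1 (Or.inl ⟨(cyc h).1, h1, h2⟩)
      unfold Cyc at this
      have := as' ih
      tauto
  have prop : ∀ x p q r, T.ArcClass a b p q → T.Arc q r → T.Arc r p → D x p → D x q →
      D x q ∧ D x r := by
    intro x p q r h h1 h2 hp hq
    have h3 := (cyc h).1
    exact ⟨hq, hp.of_cycle hV hcyc h3 h1 h2 (agree _ _ h) (agree _ _ (h.step h1 h2))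
      (agree _ _ ((h.step h1 h2).step h2 h3)) hq⟩
  -- Disagreement with both ends of one arc of the class spreads to both ends of every arc of the
  -- class. As the class spans all vertices, `x` would disagree with itself.
  have never : ∀ x p q, T.ArcClass a b p q → ¬ (D x p ∧ D x q) := by
    intro x p q h hD
    have iff : ∀ p q, T.ArcClass a b p q → ((D x p ∧ D x q) ↔ (D x a ∧ D x b)) := by
      intro p q h
      induction h with
      | base => rfl
      | @step p q r h h1 h2 ih =>
        rw [← ih]
        have h3 := (cyc h).1
        refine ⟨fun hh => ?_, fun hh => prop x p q r h h1 h2 hh.1 hh.2⟩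
        have h4 := prop x q r p (h.step h1 h2) h2 h3 hh.1 hh.2
        exact prop x r p q ((h.step h1 h2).step h2 h3) h3 h1 h4.1 h4.2
    have hxV := hD.1.left_mem
    rw [← hspan] at hxV
    obtain ⟨y, hy⟩ := hxV
    exact not_disagree_self ((iff _ _ hy).2 ((iff _ _ h).1 hD)).1
  have noD : ∀ y z, ¬ D y z := by
    intro y z hyz
    have hyV := hyz.left_mem
    rw [← hspan] at hyV
    obtain ⟨q, hyq⟩ := hyV
    obtain ⟨h1, r, h2, h3⟩ := cyc hyq
    have hqr := hyq.step h2 h3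
    -- Along a chain of disagreements starting at `y`, each new vertex takes the place of the
    -- previous one in the 3-cycle with `q` and `r`, by `twin`. So `M` omits `q`, and by `arc_iff`
    -- no outside vertex separates its elements.
    let M : Set α := {z | Relation.ReflTransGen D y z}
    have hyM : y ∈ M := Relation.ReflTransGen.refl
    have hM : ∀ z ∈ M, T.Arc z q ∧ T.Arc r z := by
      intro z hz
      induction hz with
      | refl => exact ⟨h1, h3⟩
      | @tail z w hz hzw ih =>
        have hs1 := hqr.step ih.2 ih.1
        have hs2 := hs1.step ih.1 h2
        have hwz : D w z := hzw.symm
        exact hwz.twin hV hcyc ih.1 h2 ih.2 (agree _ _ hs2) (agree _ _ hqr) (agree _ _ hs1)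
          (fun h => never w z q hs2 ⟨hwz, h⟩) (fun h => never w r z hs1 ⟨h, hwz⟩)
    have hmod : T.IsModule M := by
      refine ⟨fun z hz => lm (hM z hz).1, ?_⟩
      have one : ∀ x p q, x ∉ M → p ∈ M → D p q → (T.Arc x p ↔ T.Arc x q) := by
        intro x p q hx hp hpq
        have hq : q ∈ M := Relation.ReflTransGen.tail hp hpq
        have n1 : ¬ D p x := fun h => hx (Relation.ReflTransGen.tail hp h)
        have n2 : ¬ D q x := fun h => hx (Relation.ReflTransGen.tail hq h)
        exact hpq.arc_iff hV hcyc (by rintro rfl; exact hx hp) (by rintro rfl; exact hx hq) n1 n2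
      have all : ∀ x p, x ∉ M → p ∈ M → (T.Arc x y ↔ T.Arc x p) := by
        intro x p hx hp
        induction hp with
        | refl => rfl
        | tail hz hzw ih => exact ih.trans (one x _ _ hx hz hzw)
      intro x p q hx hp hq h
      exact (all x q hx hq).1 ((all x p hx hp).2 h)
    rcases hprime M hmod with h | h | ⟨v, h⟩
    · rw [h] at hyM; exact hyM.elim
    · exact irr q (hM q (h ▸ rm h1)).1
    · have hzM : z ∈ M := Relation.ReflTransGen.single hyz
      rw [h] at hyM hzM
      obtain rfl : y = v := hyM
      obtain rfl : z = y := hzM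
      exact not_disagree_self hyz
  refine Tournament.ext hV ?_
  funext x y
  refine propext ⟨fun h => ?_, fun h => ?_⟩
  · rcases tot (lm' h) (rm' h) (by rintro rfl; exact irr' _ h) with h' | h'
    · exact h'
    · exact absurd (Or.inr ⟨h', h⟩) (noD x y)
  · rcases tot' (lm h) (rm h) (by rintro rfl; exact irr _ h) with h' | h'
    · exact h'
    · exact absurd (Or.inl ⟨h, h'⟩) (noD x y)

/-- A tournament with only trivial modules and containing a 3-cycle is determined, up to reversal,
by its 3-cycles. -/
theorem eq_or_eq_dual_of_cyc_iff (hV : T'.vertexSet = T.vertexSet)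
    (hcyc : ∀ a b c, T.Cyc a b c ↔ T'.Cyc a b c)
    (hprime : ∀ M, T.IsModule M → M = ∅ ∨ M = T.vertexSet ∨ ∃ v, M = {v})
    {a b c : α} (habc : T.Cyc a b c) : T' = T ∨ T' = T.dual := by
  have key : ∀ a b c, T.Arc a b → T.Arc b c → T.Arc c a → T' = T ∨ T' = T.dual := by
    intro a b c h1 h2 h3
    rcases (hcyc a b c).1 (Or.inl ⟨h1, h2, h3⟩) with h | h
    · exact Or.inl (eq_of_cyc_iff_of_agree hV hcyc hprime h1 h2 h3 h.1)
    · have := eq_of_cyc_iff_of_agree (T := T) (T' := T'.dual) hV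
        (fun a b c => (hcyc a b c).trans cyc_dual.symm) hprime h1 h2 h3 h.1
      exact Or.inr (by rw [← this]; rfl)
  rcases habc with ⟨h1, h2, h3⟩ | ⟨h1, h2, h3⟩
  · exact key a b c h1 h2 h3
  · exact key b a c h1 h3 h2

end Prime

end Tournament

/-! ### Strong modules, restriction and union -/

namespace Hypergraph

section Modules

variable {α : Type*} {H : Hypergraph α}

theorem inducedOn_adj3 {W : Set α} {a b c : α} :
    (H.inducedOn W).Adj3 a b c ↔ H.Adj3 a b c ∧ a ∈ W ∧ b ∈ W ∧ c ∈ W := by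
  refine and_congr_right fun _ => ?_
  simp [Set.insert_subset_iff]

theorem IsUniformOfSize.inducedOn {k : ℕ} (hu : H.IsUniformOfSize k) (W : Set α) :
    (H.inducedOn W).IsUniformOfSize k := fun e he => hu e he.1

theorem inducedOn_inducedOn {X Y : Set α} (h : Y ⊆ X) :
    (H.inducedOn X).inducedOn Y = H.inducedOn Y :=
  Hypergraph.ext rfl (Set.ext fun _ => ⟨fun he => ⟨he.1.1, he.2⟩,
    fun he => ⟨⟨he.1, he.2.trans h⟩, he.2⟩⟩)

theorem inducedOn_vertexSet : H.inducedOn H.vertexSet = H :=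
  Hypergraph.ext rfl (Set.ext fun _ => ⟨fun he => he.1,
    fun he => ⟨he, H.subset_vertexSet_of_mem_edgeSet' he⟩⟩)

theorem isModuleSet_vertexSet : H.IsModuleSet H.vertexSet :=
  ⟨subset_rfl, fun _ he _ ⟨_, hx, hx'⟩ =>
    absurd (H.subset_vertexSet_of_mem_edgeSet' he hx) hx'⟩

theorem isModuleSet_singleton (hu : H.IsUniformOfSize 3) {v : α} (hv : v ∈ H.vertexSet) :
    H.IsModuleSet {v} := by
  refine (isModuleSet_iff hu).2 ⟨by simpa, ?_⟩
  rintro a b c h rfl -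
  refine ⟨fun hb => h.ne hu (Eq.symm hb), ?_⟩
  rintro n rfl
  exact h

theorem isStrongModule_vertexSet : H.IsStrongModule H.vertexSet :=
  ⟨isModuleSet_vertexSet, fun _ hN _ => Or.inr hN.1⟩

theorem isStrongModule_singleton (hu : H.IsUniformOfSize 3) {v : α} (hv : v ∈ H.vertexSet) :
    H.IsStrongModule {v} := by
  refine ⟨isModuleSet_singleton hu hv, fun N _ h => Or.inl ?_⟩
  rintro x rfl
  simpa using h

theorem IsStrongModule.isModule (hu : H.IsUniformOfSize 3) {X : Set α} (hX : H.IsStrongModule X)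
    {T : Tournament α} (hT : T ∈ H.realizations) : T.IsModule X := by
  by_contra h
  obtain ⟨N, hN, hne, h1, h2⟩ := Tournament.exists_isModule_overlap hu hT hX.1 h
  exact (hX.2 N (hN.isModuleSet hu hT) hne).elim h1 h2

/-- An edge leaving `X` meets it in a single vertex, which can be exchanged freely within `X`. So
only edges inside `X` constrain its subsets. -/
theorem isModuleSet_inducedOn_iff (hu : H.IsUniformOfSize 3) {X Y : Set α}
    (hX : H.IsModuleSet X) :
    (H.inducedOn X).IsModuleSet Y ↔ H.IsModuleSet Y ∧ Y ⊆ X := by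
  rw [isModuleSet_iff hu] at *
  rw [isModuleSet_iff (hu.inducedOn X)]
  simp only [inducedOn_adj3]
  constructor
  · rintro ⟨h1, h2⟩
    have h1 : Y ⊆ X := h1
    refine ⟨⟨h1.trans hX.1, fun a b c h ha hc => ?_⟩, h1⟩
    by_cases hcX : c ∈ X
    · have hbX : b ∈ X := by
        by_contra hb
        exact (hX.2 a c b h.swap.rotate (h1 ha) hb).1 hcX
      have := h2 a b c ⟨h, h1 ha, hbX, hcX⟩ ha hc
      exact ⟨this.1, fun n hn => (this.2 n hn).1⟩
    · have := hX.2 a b c h (h1 ha) hcX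
      exact ⟨fun hb => this.1 (h1 hb), fun n hn => this.2 n (h1 hn)⟩
  · rintro ⟨⟨h1, h2⟩, h3⟩
    refine ⟨h3, fun a b c ⟨h, _, hb, hc⟩ ha hcY => ?_⟩
    have := h2 a b c h ha hcY
    exact ⟨this.1, fun n hn => ⟨this.2 n hn, h3 hn, hb, hc⟩⟩

/-- A module meeting `Y` meets `X`, so it contains `X`, hence `Y`, or is itself a module of H[X]. -/
theorem isStrongModule_inducedOn_iff (hu : H.IsUniformOfSize 3) {X Y : Set α}
    (hX : H.IsStrongModule X) :
    (H.inducedOn X).IsStrongModule Y ↔ H.IsStrongModule Y ∧ Y ⊆ X := by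
  constructor
  · rintro ⟨h1, h2⟩
    obtain ⟨h1, h3⟩ := (isModuleSet_inducedOn_iff hu hX.1).1 h1
    refine ⟨⟨h1, fun N hN hne => ?_⟩, h3⟩
    rcases hX.2 N hN (hne.mono (Set.inter_subset_inter_left N h3)) with h | h
    · exact Or.inl (h3.trans h)
    · exact h2 N ((isModuleSet_inducedOn_iff hu hX.1).2 ⟨hN, h⟩) hne
  · rintro ⟨h1, h3⟩
    exact ⟨(isModuleSet_inducedOn_iff hu hX.1).2 ⟨h1.1, h3⟩,
      fun N hN => h1.2 N ((isModuleSet_inducedOn_iff hu hX.1).1 hN).1⟩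

/-- Exchange through a common vertex `p`: first move from `M` to `p`, then from `p` anywhere in `N`.
-/
theorem IsModuleSet.union (hu : H.IsUniformOfSize 3) {M N : Set α} (hM : H.IsModuleSet M)
    (hN : H.IsModuleSet N) (hne : (M ∩ N).Nonempty) : H.IsModuleSet (M ∪ N) := by
  rw [isModuleSet_iff hu] at *
  obtain ⟨p, hpM, hpN⟩ := hne
  refine ⟨Set.union_subset hM.1 hN.1, fun a b c h ha hc => ?_⟩
  have key : ∀ M N : Set α,
      (∀ a b c, H.Adj3 a b c → a ∈ M → c ∉ M → b ∉ M ∧ ∀ n ∈ M, H.Adj3 n b c) →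
      (∀ a b c, H.Adj3 a b c → a ∈ N → c ∉ N → b ∉ N ∧ ∀ n ∈ N, H.Adj3 n b c) →
      p ∈ M → p ∈ N → a ∈ M → c ∉ M → c ∉ N →
      (b ∉ M ∧ b ∉ N) ∧ (∀ n ∈ M, H.Adj3 n b c) ∧ ∀ n ∈ N, H.Adj3 n b c := by
    intro M N hM hN hpM hpN ha hcM hcN
    obtain ⟨hb, h1⟩ := hM a b c h ha hcM
    obtain ⟨hb', h2⟩ := hN p b c (h1 p hpM) hpN hcN
    exact ⟨⟨hb, hb'⟩, h1, h2⟩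
  simp only [Set.mem_union, not_or] at *
  rcases ha with ha | ha
  · obtain ⟨h1, h2, h3⟩ := key M N hM.2 hN.2 hpM hpN ha hc.1 hc.2
    exact ⟨h1, fun n hn => hn.elim (h2 n) (h3 n)⟩
  · obtain ⟨h1, h2, h3⟩ := key N M hN.2 hM.2 hpN hpM ha hc.2 hc.1
    exact ⟨h1.symm, fun n hn => hn.elim (h3 n) (h2 n)⟩

end Modules

/-! ### Maximal strong modules; the quotient is empty or prime -/

section MaxStrong

variable {α : Type*} {H : Hypergraph α}

theorem exists_mem_maxStrongModules (hfin : H.vertexSet.Finite) {N : Set α}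
    (hN : H.IsStrongModule N) (hne : N ≠ H.vertexSet) : ∃ X ∈ H.maxStrongModules, N ⊆ X := by
  have hf : {N | H.IsStrongModule N ∧ N ≠ H.vertexSet}.Finite :=
    hfin.finite_subsets.subset fun N hN => hN.1.1.1
  obtain ⟨X, hX, hmax⟩ := hf.exists_le_maximal (a := N) ⟨hN, hne⟩
  exact ⟨X, hmax, hX⟩

theorem exists_mem_maxStrongModules_mem (hu : H.IsUniformOfSize 3) (hfin : H.vertexSet.Finite)
    (hV : H.vertexSet.Nontrivial) {v : α} (hv : v ∈ H.vertexSet) :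
    ∃ X ∈ H.maxStrongModules, v ∈ X := by
  obtain ⟨X, hX, h⟩ := exists_mem_maxStrongModules hfin (isStrongModule_singleton hu hv)
    (fun h => by rw [← h] at hV; exact Set.not_nontrivial_singleton hV)
  exact ⟨X, hX, h rfl⟩

theorem maximal_of_mem_maxStrongModules {X : Set α} (hX : X ∈ H.maxStrongModules) :
    Maximal (fun N => H.IsStrongModule N ∧ N ≠ H.vertexSet) X := hX

theorem isStrongModule_of_mem_maxStrongModules {X : Set α} (hX : X ∈ H.maxStrongModules) :
    H.IsStrongModule X := (maximal_of_mem_maxStrongModules hX).prop.1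

theorem subset_of_mem_maxStrongModules {X : Set α} (hX : X ∈ H.maxStrongModules) :
    X ⊆ H.vertexSet := (maximal_of_mem_maxStrongModules hX).prop.1.1.1

theorem ne_of_mem_maxStrongModules {X : Set α} (hX : X ∈ H.maxStrongModules) :
    X ≠ H.vertexSet := (maximal_of_mem_maxStrongModules hX).prop.2

theorem eq_of_mem_maxStrongModules {X Y : Set α} (hX : X ∈ H.maxStrongModules)
    (hY : Y ∈ H.maxStrongModules) {v : α} (hvX : v ∈ X) (hvY : v ∈ Y) : X = Y := by
  have hX' := maximal_of_mem_maxStrongModules hX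
  have hY' := maximal_of_mem_maxStrongModules hY
  rcases hX'.prop.1.2 Y hY'.prop.1.1 ⟨v, hvX, hvY⟩ with h | h
  · exact hX'.eq_of_le hY'.prop h
  · exact (hY'.eq_of_le hX'.prop h).symm

theorem nonempty_of_mem_maxStrongModules (hu : H.IsUniformOfSize 3) (hfin : H.vertexSet.Finite)
    (hV : H.vertexSet.Nontrivial) {X : Set α} (hX : X ∈ H.maxStrongModules) : X.Nonempty := by
  by_contra h
  rw [Set.not_nonempty_iff_eq_empty] at h
  subst h
  obtain ⟨v, hv⟩ := hV.nonempty
  obtain ⟨Y, hY, hvY⟩ := exists_mem_maxStrongModules_mem hu hfin hV hv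
  rw [← (maximal_of_mem_maxStrongModules hX).eq_of_le
    (maximal_of_mem_maxStrongModules hY).prop (Set.empty_subset Y)] at hvY
  exact hvY

theorem finite_maxStrongModules (hfin : H.vertexSet.Finite) : H.maxStrongModules.Finite :=
  hfin.finite_subsets.subset fun _ hX => subset_of_mem_maxStrongModules hX

/-- The three vertices of an edge lie in the same maximal strong module or in three distinct
ones. -/
theorem Adj3.ne_of_ne (hu : H.IsUniformOfSize 3) {a b c : α} (h : H.Adj3 a b c) {X Y Z : Set α}
    (hX : X ∈ H.maxStrongModules) (hZ : Z ∈ H.maxStrongModules)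
    (ha : a ∈ X) (hb : b ∈ Y) (hc : c ∈ Z) (hXZ : X ≠ Z) : X ≠ Y ∧ Y ≠ Z := by
  have hcX : c ∉ X := fun h => hXZ (eq_of_mem_maxStrongModules hX hZ h hc)
  have haZ : a ∉ Z := fun h => hXZ (eq_of_mem_maxStrongModules hX hZ ha h)
  have h1 := ((isModuleSet_iff hu).1 (maximal_of_mem_maxStrongModules hX).prop.1.1).2 a b c h ha hcX
  have h2 := ((isModuleSet_iff hu).1 (maximal_of_mem_maxStrongModules hZ).prop.1.1).2 c b a
    h.rotate.swap hc haZ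
  exact ⟨fun h => h1.1 (h ▸ hb), fun h => h2.1 (h ▸ hb)⟩

theorem Adj3.transversal (hu : H.IsUniformOfSize 3) {a b c : α} (h : H.Adj3 a b c) {X Y Z : Set α}
    (hX : X ∈ H.maxStrongModules) (hY : Y ∈ H.maxStrongModules) (hZ : Z ∈ H.maxStrongModules)
    (ha : a ∈ X) (hb : b ∈ Y) (hc : c ∈ Z) (hXY : X ≠ Y) (hYZ : Y ≠ Z) (hXZ : X ≠ Z)
    {a' b' c' : α} (ha' : a' ∈ X) (hb' : b' ∈ Y) (hc' : c' ∈ Z) : H.Adj3 a' b' c' := by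
  have one : ∀ {X Z : Set α} {a b c : α}, X ∈ H.maxStrongModules → Z ∈ H.maxStrongModules →
      X ≠ Z → a ∈ X → c ∈ Z → H.Adj3 a b c → ∀ n ∈ X, H.Adj3 n b c := by
    intro X Z a b c hX hZ hXZ ha hc h
    exact (((isModuleSet_iff hu).1 (maximal_of_mem_maxStrongModules hX).prop.1.1).2 a b c h ha
      (fun h => hXZ (eq_of_mem_maxStrongModules hX hZ h hc))).2
  have h1 := one hX hZ hXZ ha hc h a' ha'
  have h2 := one hY hX hXY.symm hb ha' h1.rotate b' hb'
  have h3 := one hZ hY hYZ.symm hc hb' h2.rotate c' hc'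
  exact h3.rotate

/-- The Gallai quotient `H/Π(H)`. -/
def quotient (H : Hypergraph α) : Hypergraph (Set α) := H.quotientBy H.maxStrongModules

theorem quotient_isUniformOfSize (hu : H.IsUniformOfSize 3) (hfin : H.vertexSet.Finite)
    (hV : H.vertexSet.Nontrivial) : H.quotient.IsUniformOfSize 3 := by
  rintro F ⟨hF, h2, e, he, hFe⟩
  obtain ⟨X, Z, hX, hZ, hXZ⟩ := Set.one_lt_encard_iff.1
    (lt_of_lt_of_le (by norm_num) h2 : 1 < F.encard)
  have hX' := hX
  have hZ' := hZ
  rw [hFe] at hX' hZ'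
  obtain ⟨hXP, a, haX, hae⟩ := hX'
  obtain ⟨hZP, c, hcZ, hce⟩ := hZ'
  have hac : a ≠ c := by
    rintro rfl
    exact hXZ (eq_of_mem_maxStrongModules hXP hZP haX hcZ)
  obtain ⟨b, rfl⟩ := hu.exists_third he hae hce hac
  have hbV : b ∈ H.vertexSet := H.subset_vertexSet_of_mem_edgeSet' he (by simp)
  obtain ⟨Y, hYP, hbY⟩ := exists_mem_maxStrongModules_mem hu hfin hV hbV
  obtain ⟨hXY, hYZ⟩ := Adj3.ne_of_ne hu he hXP hZP haX hbY hcZ hXZ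
  refine Set.encard_eq_three.2 ⟨X, Y, Z, hXY, hXZ, hYZ, ?_⟩
  rw [hFe]
  ext W
  simp only [Set.mem_ofPred_eq, Set.mem_insert_iff, Set.mem_singleton_iff]
  constructor
  · rintro ⟨hW, x, hxW, rfl | rfl | rfl⟩
    · exact Or.inl (eq_of_mem_maxStrongModules hW hXP hxW haX)
    · exact Or.inr (Or.inl (eq_of_mem_maxStrongModules hW hYP hxW hbY))
    · exact Or.inr (Or.inr (eq_of_mem_maxStrongModules hW hZP hxW hcZ))
  · rintro (rfl | rfl | rfl)
    · exact ⟨hXP, a, haX, by simp⟩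
    · exact ⟨hYP, b, hbY, by simp⟩
    · exact ⟨hZP, c, hcZ, by simp⟩

theorem quotient_adj3_iff (hu : H.IsUniformOfSize 3) (hfin : H.vertexSet.Finite)
    (hV : H.vertexSet.Nontrivial) {X Y Z : Set α} :
    H.quotient.Adj3 X Y Z ↔
      (X ∈ H.maxStrongModules ∧ Y ∈ H.maxStrongModules ∧ Z ∈ H.maxStrongModules) ∧
      (X ≠ Y ∧ Y ≠ Z ∧ X ≠ Z) ∧ ∃ a ∈ X, ∃ b ∈ Y, ∃ c ∈ Z, H.Adj3 a b c := by
  constructor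
  · intro h
    have hK := quotient_isUniformOfSize hu hfin hV
    have hXY : X ≠ Y := h.ne hK
    have hYZ : Y ≠ Z := h.rotate.ne hK
    have hXZ : X ≠ Z := (h.rotate.rotate.ne hK).symm
    refine ⟨⟨h.mem, h.rotate.mem, h.rotate.rotate.mem⟩, ⟨hXY, hYZ, hXZ⟩, ?_⟩
    obtain ⟨hF, h2, e, he, hFe⟩ := h
    have mem : ∀ W ∈ ({X, Y, Z} : Set (Set α)), W ∈ H.maxStrongModules ∧ (W ∩ e).Nonempty := by
      intro W hW
      rw [hFe] at hW
      exact hW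
    obtain ⟨hX, a, haX, hae⟩ := mem X (by simp)
    obtain ⟨hY, b, hbY, hbe⟩ := mem Y (by simp)
    obtain ⟨hZ, c, hcZ, hce⟩ := mem Z (by simp)
    have hac : a ≠ c := by
      rintro rfl
      exact hXZ (eq_of_mem_maxStrongModules hX hZ haX hcZ)
    obtain ⟨b', rfl⟩ := hu.exists_third he hae hce hac
    rcases hbe with rfl | rfl | rfl
    · exact absurd (eq_of_mem_maxStrongModules hX hY haX hbY) hXY
    · exact ⟨a, haX, b, hbY, c, hcZ, he⟩
    · exact absurd (eq_of_mem_maxStrongModules hY hZ hbY hcZ) hYZ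
  · rintro ⟨⟨hX, hY, hZ⟩, ⟨hXY, hYZ, hXZ⟩, a, haX, b, hbY, c, hcZ, h⟩
    refine ⟨?_, ?_, _, h, ?_⟩
    · rintro W (rfl | rfl | rfl) <;> assumption
    · rw [Set.encard_eq_three.2 ⟨X, Y, Z, hXY, hXZ, hYZ, rfl⟩]
      norm_num
    · ext W
      simp only [Set.mem_ofPred_eq, Set.mem_insert_iff, Set.mem_singleton_iff]
      constructor
      · rintro (rfl | rfl | rfl)
        · exact ⟨hX, a, haX, by simp⟩
        · exact ⟨hY, b, hbY, by simp⟩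
        · exact ⟨hZ, c, hcZ, by simp⟩
      · rintro ⟨hW, x, hxW, rfl | rfl | rfl⟩
        · exact Or.inl (eq_of_mem_maxStrongModules hW hX hxW haX)
        · exact Or.inr (Or.inl (eq_of_mem_maxStrongModules hW hY hxW hbY))
        · exact Or.inr (Or.inr (eq_of_mem_maxStrongModules hW hZ hxW hcZ))

/-- No edge of `H` crosses the set `S` of vertices. -/
def IsClosedSet (H : Hypergraph α) (S : Set α) : Prop :=
  S ⊆ H.vertexSet ∧ ∀ a b c, H.Adj3 a b c → a ∈ S → b ∈ S

theorem IsClosedSet.isModuleSet (hu : H.IsUniformOfSize 3) {S : Set α} (hS : H.IsClosedSet S) :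
    H.IsModuleSet S :=
  (isModuleSet_iff hu).2 ⟨hS.1, fun a b c h ha hc =>
    absurd (hS.2 b c a h.rotate (hS.2 a b c h ha)) hc⟩

theorem IsClosedSet.compl {S : Set α} (hS : H.IsClosedSet S) :
    H.IsClosedSet (H.vertexSet \ S) :=
  ⟨Set.sdiff_subset, fun a b c h ha => ⟨h.rotate.mem, fun hb => ha.2 (hS.2 b a c h.swap hb)⟩⟩

/-- The connected component of a vertex. -/
def component (H : Hypergraph α) (v : α) : Set α :=
  {u | ∀ S, H.IsClosedSet S → v ∈ S → u ∈ S}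

theorem isClosedSet_vertexSet : H.IsClosedSet H.vertexSet :=
  ⟨subset_rfl, fun _ _ _ h _ => h.rotate.mem⟩

theorem isClosedSet_component {v : α} (hv : v ∈ H.vertexSet) : H.IsClosedSet (H.component v) :=
  ⟨fun _ hu => hu _ isClosedSet_vertexSet hv,
    fun a b c h ha S hS hvS => hS.2 a b c h (ha S hS hvS)⟩

/-- Suppose that `N` meets the component and contains a vertex `y` outside it. An edge of the
component passing from `N` to its complement could have its vertex in `N` exchanged for `y`, giving
an edge that leaves the component. So `N` cuts the component into two closed pieces, one of which
must be empty. -/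
theorem isStrongModule_component (hu : H.IsUniformOfSize 3) {v : α} (hv : v ∈ H.vertexSet) :
    H.IsStrongModule (H.component v) := by
  have hC := isClosedSet_component hv
  refine ⟨hC.isModuleSet hu, fun N hN hne => ?_⟩
  by_contra! hcon
  obtain ⟨hCN, hNC⟩ := hcon
  obtain ⟨y, hyN, hyC⟩ := Set.not_subset.1 hNC
  obtain ⟨x, hxC, hxN⟩ := Set.not_subset.1 hCN
  obtain ⟨z, hzC, hzN⟩ := hne
  have hN' := ((isModuleSet_iff hu).1 hN).2
  have stay : ∀ a b c, H.Adj3 a b c → a ∈ H.component v → a ∈ N → b ∈ N := by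
    intro a b c h haC haN
    by_contra hb
    have h1 := (hN' a c b h.swap.rotate haN hb).2 y hyN
    have hc : c ∈ H.component v := hC.2 b c a h.rotate (hC.2 a b c h haC)
    exact hyC (hC.2 c y b h1.swap hc)
  have h1 : H.IsClosedSet (H.component v ∩ N) :=
    ⟨Set.inter_subset_left.trans hC.1, fun a b c h ha => ⟨hC.2 a b c h ha.1, stay a b c h ha.1 ha.2⟩⟩
  have h2 : H.IsClosedSet (H.component v \ N) :=
    ⟨Set.sdiff_subset.trans hC.1, fun a b c h ha => ⟨hC.2 a b c h ha.1,
      fun hb => ha.2 (stay b a c h.swap (hC.2 a b c h ha.1) hb)⟩⟩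
  have hvC : v ∈ H.component v := fun S _ h => h
  by_cases hvN : v ∈ N
  · exact hxN (hxC _ h1 ⟨hvC, hvN⟩).2
  · exact (hzC _ h2 ⟨hvC, hvN⟩).2 hzN

/-- In the disconnected case each component is a proper strong module, hence lies in one block. An
edge lies in one component, so no edge meets two blocks. -/
theorem quotient_hasNoEdge (hu : H.IsUniformOfSize 3) (hfin : H.vertexSet.Finite)
    (hV : H.vertexSet.Nontrivial) {S : Set α} (hS : H.IsClosedSet S) (hne : S.Nonempty)
    (hSV : S ≠ H.vertexSet) : H.quotient.HasNoEdge := by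
  refine Set.eq_empty_iff_forall_notMem.2 fun F hF => ?_
  obtain ⟨X, Y, Z, -, -, -, rfl⟩ := (quotient_isUniformOfSize hu hfin hV).exists_eq hF
  obtain ⟨⟨hX, hY, -⟩, ⟨hXY, -, -⟩, a, ha, b, hb, c, hc, h⟩ :=
    (quotient_adj3_iff hu hfin hV).1 hF
  have hC := isClosedSet_component h.mem
  have haC : a ∈ H.component a := fun S _ h => h
  have hbC : b ∈ H.component a := hC.2 a b c h haC
  obtain ⟨s, hs⟩ := hne
  obtain ⟨t, htV, ht⟩ := Set.not_subset.1 (fun h => hSV (hS.1.antisymm h))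
  have hCV : H.component a ≠ H.vertexSet := by
    intro hCV
    by_cases haS : a ∈ S
    · have : t ∈ H.component a := hCV ▸ htV
      exact ht (this S hS haS)
    · have : s ∈ H.component a := hCV ▸ hS.1 hs
      exact (this _ hS.compl ⟨h.mem, haS⟩).2 hs
  obtain ⟨W, hW, hCW⟩ := exists_mem_maxStrongModules hfin (isStrongModule_component hu h.mem) hCV
  exact hXY ((eq_of_mem_maxStrongModules hX hW ha (hCW haC)).trans
    (eq_of_mem_maxStrongModules hW hY (hCW hbC) hb))

/-- If `N` overlaps `M`, maximality makes their union everything, so `N` contains the complement of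
`M`. In an edge crossing `M`, exchanging its vertex in `M` for one outside `N` gives an edge with
exactly two vertices in `N`, which is impossible. So no edge crosses `M`, against connectedness. -/
theorem isStrongModule_of_maximal (hu : H.IsUniformOfSize 3)
    (hconn : ∀ S, H.IsClosedSet S → S.Nonempty → S = H.vertexSet) {M : Set α}
    (hM : Maximal (fun N => H.IsModuleSet N ∧ N ≠ H.vertexSet) M) : H.IsStrongModule M := by
  refine ⟨hM.prop.1, fun N hN hne => ?_⟩
  by_contra! hcon
  obtain ⟨hMN, hNM⟩ := hcon
  have hU : M ∪ N = H.vertexSet := by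
    by_contra h
    have := hM.eq_of_le ⟨hM.prop.1.union hu hN hne, h⟩ Set.subset_union_left
    exact hNM (this ▸ Set.subset_union_right)
  obtain ⟨y, hyM, hyN⟩ := Set.not_subset.1 hMN
  have hM' := ((isModuleSet_iff hu).1 hM.prop.1).2
  have hN' := ((isModuleSet_iff hu).1 hN).2
  refine hM.prop.2 (hconn M ⟨hM.prop.1.1, fun a b c h ha => ?_⟩ (hne.mono Set.inter_subset_left))
  by_contra hb
  have out : ∀ {x}, x ∈ H.vertexSet → x ∉ M → x ∈ N := fun {x} hx hxM => by
    rw [← hU] at hx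
    exact hx.resolve_left hxM
  have h' : H.Adj3 a c b := h.swap.rotate
  obtain ⟨hc, hs⟩ := hM' a c b h' ha hb
  have hbN : b ∈ N := out h.rotate.mem hb
  have hcN : c ∈ N := out h'.rotate.mem hc
  exact (hN' c b y (hs y hyM).rotate hcN hyN).1 hbN

/-- A nontrivial module of the quotient has as its union a proper module of `H` containing two
blocks. A maximal proper module above it is strong by `isStrongModule_of_maximal`, which contradicts
the maximality of a block. -/
theorem quotient_isPrimeHypergraph (hu : H.IsUniformOfSize 3) (hfin : H.vertexSet.Finite)
    (hV : H.vertexSet.Nontrivial)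
    (hconn : ∀ S, H.IsClosedSet S → S.Nonempty → S = H.vertexSet) :
    H.quotient.IsPrimeHypergraph := by
  have hK := quotient_isUniformOfSize hu hfin hV
  have part := fun {v : α} (hv : v ∈ H.vertexSet) => exists_mem_maxStrongModules_mem hu hfin hV hv
  constructor
  · obtain ⟨v, hv⟩ := hV.nonempty
    obtain ⟨X, hX, hvX⟩ := part hv
    have : ¬ H.IsClosedSet X := fun h =>
      ne_of_mem_maxStrongModules hX (hconn X h ⟨v, hvX⟩)
    have : ∃ a c b, H.Adj3 a c b ∧ a ∈ X ∧ c ∉ X := by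
      by_contra! hcon
      exact this ⟨subset_of_mem_maxStrongModules hX, hcon⟩
    obtain ⟨a, c, b, h, ha, hc⟩ := this
    obtain ⟨Z, hZ, hcZ⟩ := part h.rotate.mem
    obtain ⟨Y, hY, hbY⟩ := part h.rotate.rotate.mem
    have hXZ : X ≠ Z := by rintro rfl; exact hc hcZ
    obtain ⟨hXY, hYZ⟩ := Adj3.ne_of_ne hu h.rotate.rotate.swap hX hZ ha hbY hcZ hXZ
    have hsub : ({X, Y, Z} : Set (Set α)) ⊆ H.quotient.vertexSet := by
      rintro W (rfl | rfl | rfl) <;> assumption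
    rw [← Set.encard_eq_three.2 ⟨X, Y, Z, hXY, hXZ, hYZ, rfl⟩]
    exact Set.encard_le_encard hsub
  · intro M hM
    by_contra! hcon
    obtain ⟨hne, hMV, hsing⟩ := hcon
    obtain ⟨X, hXM⟩ := hne
    obtain ⟨hMP, hM'⟩ := (isModuleSet_iff hK).1 hM
    have hMP : M ⊆ H.maxStrongModules := hMP
    obtain ⟨Y, hYM, hXY⟩ : ∃ Y ∈ M, Y ≠ X := by
      by_contra! hc
      exact hsing X (Set.eq_singleton_iff_unique_mem.2 ⟨hXM, hc⟩)
    obtain ⟨W, hW, hWM⟩ := Set.not_subset.1 (fun h => hMV (Set.Subset.antisymm hMP h))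
    have hW : W ∈ H.maxStrongModules := hW
    have memU : ∀ {v Z}, Z ∈ H.maxStrongModules → v ∈ Z → (v ∈ ⋃₀ M ↔ Z ∈ M) := by
      intro v Z hZ hv
      refine ⟨fun ⟨Z', hZ', hv'⟩ => ?_, fun h => ⟨Z, h, hv⟩⟩
      rwa [eq_of_mem_maxStrongModules hZ (hMP hZ') hv hv']
    have hmod : H.IsModuleSet (⋃₀ M) := by
      refine (isModuleSet_iff hu).2 ⟨Set.sUnion_subset fun Z hZ =>
        subset_of_mem_maxStrongModules (hMP hZ), ?_⟩
      rintro a b c h ⟨A, hA, haA⟩ hc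
      obtain ⟨B, hB, hbB⟩ := part h.rotate.mem
      obtain ⟨C, hC, hcC⟩ := part h.rotate.rotate.mem
      rw [memU hC hcC] at hc
      have hAC : A ≠ C := by rintro rfl; exact hc hA
      obtain ⟨hAB, hBC⟩ := h.ne_of_ne hu (hMP hA) hC haA hbB hcC hAC
      obtain ⟨h1, h2⟩ := hM' A B C ((quotient_adj3_iff hu hfin hV).2
        ⟨⟨hMP hA, hB, hC⟩, ⟨hAB, hBC, hAC⟩, a, haA, b, hbB, c, hcC, h⟩) hA hc
      rw [memU hB hbB]
      refine ⟨h1, ?_⟩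
      rintro n ⟨D, hD, hnD⟩
      obtain ⟨⟨k1, k2, k3⟩, ⟨l1, l2, l3⟩, a', ha', b', hb', c', hc', h'⟩ :=
        (quotient_adj3_iff hu hfin hV).1 (h2 D hD)
      exact h'.transversal hu k1 k2 k3 ha' hb' hc' l1 l2 l3 hnD hbB hcC
    have hUV : ⋃₀ M ≠ H.vertexSet := by
      intro h
      obtain ⟨w, hw⟩ := nonempty_of_mem_maxStrongModules hu hfin hV hW
      have : w ∈ ⋃₀ M := h ▸ subset_of_mem_maxStrongModules hW hw
      exact hWM ((memU hW hw).1 this)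
    have hf : {N | H.IsModuleSet N ∧ N ≠ H.vertexSet}.Finite :=
      hfin.finite_subsets.subset fun N hN => hN.1.1
    obtain ⟨Z, hUZ, hZ⟩ := hf.exists_le_maximal (a := ⋃₀ M) ⟨hmod, hUV⟩
    have hZs := isStrongModule_of_maximal hu hconn hZ
    have hXU : X ⊆ ⋃₀ M := Set.subset_sUnion_of_mem hXM
    have hXZ : X = Z := (maximal_of_mem_maxStrongModules (hMP hXM)).eq_of_le
      ⟨hZs, hZ.prop.2⟩ (hXU.trans hUZ)
    obtain ⟨y, hy⟩ := nonempty_of_mem_maxStrongModules hu hfin hV (hMP hYM)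
    have hyX : y ∈ X := hXZ ▸ hUZ ⟨Y, hYM, hy⟩
    exact hXY (eq_of_mem_maxStrongModules (hMP hYM) (hMP hXM) hy hyX)

theorem quotient_hasNoEdge_or_isPrimeHypergraph (hu : H.IsUniformOfSize 3)
    (hfin : H.vertexSet.Finite) (hV : H.vertexSet.Nontrivial) :
    H.quotient.HasNoEdge ∨ H.quotient.IsPrimeHypergraph := by
  by_cases h : ∀ S, H.IsClosedSet S → S.Nonempty → S = H.vertexSet
  · exact Or.inr (quotient_isPrimeHypergraph hu hfin hV h)
  · push Not at h
    obtain ⟨S, hS, hne, hSV⟩ := h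
    exact Or.inl (quotient_hasNoEdge hu hfin hV hS hne hSV)

/-- Without edges every set of vertices is a module, in particular a pair, which is nontrivial among
at least three vertices. -/
theorem IsPrimeHypergraph.exists_adj3 (hu : H.IsUniformOfSize 3) (hH : H.IsPrimeHypergraph) :
    ∃ a b c, H.Adj3 a b c := by
  by_contra! hno
  obtain ⟨V, hV, h3⟩ := Set.exists_subset_encard_eq hH.1
  obtain ⟨a, b, c, hab, hac, hbc, rfl⟩ := Set.encard_eq_three.1 h3
  have hm : H.IsModuleSet {a, b} :=
    (isModuleSet_iff hu).2 ⟨fun x hx => hV (by rcases hx with rfl | rfl <;> simp),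
      fun a b c h => absurd h (hno a b c)⟩
  rcases hH.2 _ hm with h | h | ⟨v, h⟩
  · exact (Set.insert_nonempty _ _).ne_empty h
  · have : c ∈ ({a, b} : Set α) := h ▸ hV (by simp)
    rcases this with rfl | rfl
    exacts [hac rfl, hbc rfl]
  · have h1 : a ∈ ({v} : Set α) := h ▸ by simp
    have h2 : b ∈ ({v} : Set α) := h ▸ by simp
    exact hab (h1.trans h2.symm)

theorem IsPrimeHypergraph.not_hasNoEdge (hu : H.IsUniformOfSize 3) (hH : H.IsPrimeHypergraph) :
    ¬ H.HasNoEdge := by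
  intro h
  obtain ⟨a, b, c, habc⟩ := hH.exists_adj3 hu
  unfold Adj3 at habc
  rw [h] at habc
  exact habc

end MaxStrong

end Hypergraph

/-! ### Realizations of prime and empty hypergraphs; quotients and substitution -/

namespace Tournament

section Counting

variable {α : Type*} {T T' : Tournament α} {H : Hypergraph α}

theorem dual_mem_realizations (hu : H.IsUniformOfSize 3) (hT : T ∈ H.realizations) :
    T.dual ∈ H.realizations := by
  rw [mem_realizations_iff hu] at *
  exact ⟨hT.1, fun a b c => (hT.2 a b c).trans cyc_dual.symm⟩

/-- A prime realizable 3-uniform hypergraph has exactly two realizations. -/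
theorem ncard_realizations_of_isPrimeHypergraph (hu : H.IsUniformOfSize 3)
    (hH : H.IsPrimeHypergraph) (hreal : H.IsRealizable) : H.realizations.ncard = 2 := by
  obtain ⟨T, hT⟩ := hreal
  obtain ⟨a, b, c, habc⟩ := hH.exists_adj3 hu
  obtain ⟨hV, hE⟩ := (mem_realizations_iff hu).1 hT
  have hc := (hE a b c).1 habc
  have hne : T ≠ T.dual := by
    intro h
    have h' : ∀ x y, T.Arc x y → T.Arc y x := fun x y hxy => by
      rw [h] at hxy
      exact hxy
    rcases hc with h1 | h1 <;> exact T.asymm h1.1 (h' _ _ h1.1)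
  have : H.realizations = {T, T.dual} := by
    ext T'
    simp only [Set.mem_insert_iff, Set.mem_singleton_iff]
    constructor
    · intro hT'
      obtain ⟨hV', hE'⟩ := (mem_realizations_iff hu).1 hT'
      refine eq_or_eq_dual_of_cyc_iff (hV'.trans hV.symm)
        (fun a b c => (hE a b c).symm.trans (hE' a b c)) (fun M hM => ?_) hc
      rw [hV]
      exact hH.2 M (hM.isModuleSet hu hT)
    · rintro (rfl | rfl)
      · exact hT
      · exact dual_mem_realizations hu hT
  rw [this, Set.ncard_pair hne]

/-- The transitive tournament given by a numbering of the vertices. -/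
def ofEquivFin {V : Set α} {n : ℕ} (e : V ≃ Fin n) : Tournament α where
  vertexSet := V
  Arc v w := ∃ (hv : v ∈ V) (hw : w ∈ V), e ⟨v, hv⟩ < e ⟨w, hw⟩
  left_mem := fun h => h.1
  right_mem := fun h => h.2.1
  asymm := fun ⟨_, _, h⟩ ⟨_, _, h'⟩ => lt_asymm h h'
  total := fun {v w} hv hw hne => by
    rcases lt_trichotomy (e ⟨v, hv⟩) (e ⟨w, hw⟩) with h | h | h
    · exact Or.inl ⟨hv, hw, h⟩
    · exact absurd (congrArg Subtype.val (e.injective h)) hne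
    · exact Or.inr ⟨hw, hv, h⟩

/-- The realizations of an empty hypergraph are the linear orders on its vertices. -/
theorem ncard_realizations_of_hasNoEdge (hu : H.IsUniformOfSize 3) (hfin : H.vertexSet.Finite)
    (hH : H.HasNoEdge) : H.realizations.ncard = H.vertexSet.ncard.factorial := by
  classical
  have := hfin.fintype
  have hcard : Fintype.card H.vertexSet = H.vertexSet.ncard := by
    rw [← Nat.card_coe_set_eq, Nat.card_eq_fintype_card]
  have hno : ∀ a b c, ¬ H.Adj3 a b c := by
    intro a b c h
    unfold Hypergraph.Adj3 at h
    rw [hH] at h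
    exact h
  let f : (H.vertexSet ≃ Fin H.vertexSet.ncard) → H.realizations := fun e =>
    ⟨ofEquivFin e, (mem_realizations_iff hu).2 ⟨rfl, fun a b c => ⟨fun h => absurd h (hno a b c), by
      rintro (⟨⟨_, _, h1⟩, ⟨_, _, h2⟩, ⟨_, _, h3⟩⟩ | ⟨⟨_, _, h1⟩, ⟨_, _, h2⟩, ⟨_, _, h3⟩⟩)
      · exact absurd (h1.trans h2) (lt_asymm h3)
      · exact absurd (h2.trans h1) (lt_asymm h3)⟩⟩⟩
  have hf : Function.Bijective f := by
    constructor
    · intro e e' h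
      have harc : ∀ v w, e v < e w → e' v < e' w := by
        intro v w hvw
        have h1 : (ofEquivFin e).Arc v w := ⟨v.2, w.2, hvw⟩
        rw [show ofEquivFin e = ofEquivFin e' from congrArg Subtype.val h] at h1
        exact h1.2.2
      -- Two numberings with the same tournament differ by an increasing permutation of `Fin n`,
      -- which is the identity.
      have hmono : StrictMono (e.symm.trans e') := by
        intro i j hij
        exact harc _ _ (by simpa using hij)
      have : (e.symm.trans e' : Fin _ → Fin _) = id := by
        have h1 := Subsingleton.elim
          (hmono.orderIsoOfSurjective _ (e.symm.trans e').surjective) (OrderIso.refl _)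
        funext i
        exact DFunLike.congr_fun h1 i
      ext v
      have := congrFun this (e v)
      simp at this
      rw [this]
    · rintro ⟨T, hT⟩
      obtain ⟨hV, hE⟩ := (mem_realizations_iff hu).1 hT
      have hmem : ∀ v ∈ H.vertexSet, v ∈ T.vertexSet := fun v h => hV ▸ h
      -- A tournament without 3-cycles is transitive, hence a strict linear order.
      have hsto : IsStrictTotalOrder H.vertexSet (fun v w => T.Arc v w) :=
        { irrefl := fun v => T.irrefl v
          trans := fun a b c hab hbc => by
            have hac : (a : α) ≠ c := fun h => T.asymm hab (h ▸ hbc)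
            rcases T.total (hmem _ a.2) (hmem _ c.2) hac with h | h
            · exact h
            · exact absurd ((hE a b c).2 (Or.inl ⟨hab, hbc, h⟩)) (hno _ _ _)
          trichotomous := fun a b h1 h2 => by
            by_contra hne
            exact (T.total (hmem _ a.2) (hmem _ b.2) (fun h => hne (Subtype.ext h))).elim h1 h2 }
      let _ : LinearOrder H.vertexSet := linearOrderOfSTO (fun v w : H.vertexSet => T.Arc v w)
      let e := (Fintype.orderIsoFinOfCardEq H.vertexSet hcard).symm
      have he : ∀ v w : H.vertexSet, e v < e w ↔ T.Arc v w := fun v w => e.lt_iff_lt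
      refine ⟨e.toEquiv, Subtype.ext (Tournament.ext hV.symm ?_)⟩
      funext v w
      refine propext ⟨fun ⟨hv, hw, h⟩ => (he _ _).1 h, fun h => ?_⟩
      have hv : v ∈ H.vertexSet := hV ▸ T.left_mem h
      have hw : w ∈ H.vertexSet := hV ▸ T.right_mem h
      exact ⟨hv, hw, (he ⟨v, hv⟩ ⟨w, hw⟩).2 h⟩
  rw [← Nat.card_coe_set_eq, ← Nat.card_congr (Equiv.ofBijective f hf),
    Nat.card_eq_fintype_card, Fintype.card_equiv (Fintype.equivFinOfCardEq hcard), hcard]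

theorem cyc_inducedOn {W : Set α} {a b c : α} :
    (T.inducedOn W).Cyc a b c ↔ T.Cyc a b c ∧ a ∈ W ∧ b ∈ W ∧ c ∈ W := by
  unfold Cyc inducedOn
  tauto

theorem inducedOn_mem_realizations (hu : H.IsUniformOfSize 3) (hT : T ∈ H.realizations) {W : Set α}
    (hW : W ⊆ H.vertexSet) : T.inducedOn W ∈ (H.inducedOn W).realizations := by
  rw [mem_realizations_iff hu] at hT
  refine (mem_realizations_iff (hu.inducedOn W)).2 ⟨?_, fun a b c => ?_⟩
  · change T.vertexSet ∩ W = W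
    rw [hT.1]
    exact Set.inter_eq_right.2 hW
  · rw [Hypergraph.inducedOn_adj3, cyc_inducedOn, hT.2]

theorem Cyc.rotate {a b c : α} (h : T.Cyc a b c) : T.Cyc b c a := by
  unfold Cyc at *; tauto

theorem Cyc.left_mem {a b c : α} (h : T.Cyc a b c) : a ∈ T.vertexSet := by
  rcases h with h | h
  exacts [T.left_mem h.1, T.right_mem h.1]

theorem Cyc.ne {a b c : α} (h : T.Cyc a b c) : a ≠ b := by
  rintro rfl
  rcases h with h | h <;> exact T.irrefl _ h.1

/-- The quotient of a tournament by a partition into modules. -/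
def quotient (T : Tournament α) (P : Set (Set α)) (hne : ∀ X ∈ P, X.Nonempty)
    (hdisj : ∀ X ∈ P, ∀ Y ∈ P, ∀ v, v ∈ X → v ∈ Y → X = Y) (hmod : ∀ X ∈ P, T.IsModule X) :
    Tournament (Set α) where
  vertexSet := P
  Arc X Y := X ∈ P ∧ Y ∈ P ∧ X ≠ Y ∧ ∃ a ∈ X, ∃ b ∈ Y, T.Arc a b
  left_mem := fun h => h.1
  right_mem := fun h => h.2.1
  asymm := by
    rintro X Y ⟨hX, hY, hXY, a, ha, b, hb, hab⟩ ⟨-, -, -, b', hb', a', ha', hba⟩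
    have h1 := (hmod X hX).arc_left (fun h => hXY (hdisj X hX Y hY b h hb)) ha ha' hab
    have h2 := (hmod Y hY).2 a' b b' (fun h => hXY (hdisj X hX Y hY a' ha' h)) hb hb' h1
    exact T.asymm h2 hba
  total := by
    intro X Y hX hY hXY
    obtain ⟨a, ha⟩ := hne X hX
    obtain ⟨b, hb⟩ := hne Y hY
    have hab : a ≠ b := by
      rintro rfl
      exact hXY (hdisj X hX Y hY a ha hb)
    exact (T.total ((hmod X hX).1 ha) ((hmod Y hY).1 hb) hab).imp
      (fun h => ⟨hX, hY, hXY, a, ha, b, hb, h⟩) (fun h => ⟨hY, hX, hXY.symm, b, hb, a, ha, h⟩)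

/-- The tournament obtained by substituting tournaments for the vertices of a tournament. -/
def lexSum (V : Set α) (P : Set (Set α)) (hcov : ∀ v ∈ V, ∃ X ∈ P, v ∈ X) (hsub : ∀ X ∈ P, X ⊆ V)
    (hdisj : ∀ X ∈ P, ∀ Y ∈ P, ∀ v, v ∈ X → v ∈ Y → X = Y) (Q : Tournament (Set α))
    (hQ : Q.vertexSet = P) (S : P → Tournament α) (hS : ∀ X, (S X).vertexSet = X) :
    Tournament α where
  vertexSet := V
  Arc v w := (∃ X, (S X).Arc v w) ∨ ∃ X Y, Q.Arc X Y ∧ v ∈ X ∧ w ∈ Y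
  left_mem := by
    rintro v w (⟨X, h⟩ | ⟨X, Y, h, hv, hw⟩)
    · exact hsub X X.2 (hS X ▸ (S X).left_mem h)
    · exact hsub X (hQ ▸ Q.left_mem h) hv
  right_mem := by
    rintro v w (⟨X, h⟩ | ⟨X, Y, h, hv, hw⟩)
    · exact hsub X X.2 (hS X ▸ (S X).right_mem h)
    · exact hsub Y (hQ ▸ Q.right_mem h) hw
  asymm := by
    have key : ∀ {v w X Y Z}, (S X).Arc v w → Q.Arc Y Z → v ∈ Z → w ∈ Y → False := by
      intro v w X Y Z h h' hv hw
      have h1 := hdisj X X.2 Z (hQ ▸ Q.right_mem h') v (hS X ▸ (S X).left_mem h) hv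
      have h2 := hdisj X X.2 Y (hQ ▸ Q.left_mem h') w (hS X ▸ (S X).right_mem h) hw
      rw [← h1, ← h2] at h'
      exact Q.irrefl _ h'
    rintro v w (⟨X, h⟩ | ⟨X, Y, h, hv, hw⟩) (⟨X', h'⟩ | ⟨X', Y', h', hw', hv'⟩)
    · obtain rfl : X = X' := Subtype.ext (hdisj X X.2 X' X'.2 v (hS X ▸ (S X).left_mem h)
        (hS X' ▸ (S X').right_mem h'))
      exact (S X).asymm h h'
    · exact key h h' hv' hw'
    · exact key h' h hw hv
    · have h1 := hdisj X (hQ ▸ Q.left_mem h) Y' (hQ ▸ Q.right_mem h') v hv hv'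
      have h2 := hdisj Y (hQ ▸ Q.right_mem h) X' (hQ ▸ Q.left_mem h') w hw hw'
      subst h1 h2
      exact Q.asymm h h'
  total := by
    intro v w hv hw hne
    obtain ⟨X, hX, hvX⟩ := hcov v hv
    obtain ⟨Y, hY, hwY⟩ := hcov w hw
    by_cases hXY : X = Y
    · subst hXY
      exact ((S ⟨X, hX⟩).total ((hS ⟨X, hX⟩).symm ▸ hvX) ((hS ⟨X, hX⟩).symm ▸ hwY) hne).imp
        (fun h => Or.inl ⟨_, h⟩) (fun h => Or.inl ⟨_, h⟩)
    · exact (Q.total (hQ.symm ▸ hX) (hQ.symm ▸ hY) hXY).imp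
        (fun h => Or.inr ⟨_, _, h, hvX, hwY⟩) (fun h => Or.inr ⟨_, _, h, hwY, hvX⟩)

end Counting

end Tournament

/-! ### Decomposition of a realization over the maximal strong modules -/

namespace Tournament

section Decomposition

variable {α : Type*} {T T' : Tournament α} {H : Hypergraph α}

/-- A tournament orients every pair, so its arc relation cannot be properly contained in that of
another tournament on the same vertices. -/
theorem eq_of_arc_imp (hV : T.vertexSet = T'.vertexSet) (h : ∀ v w, T.Arc v w → T'.Arc v w) :
    T = T' := by
  refine Tournament.ext hV ?_
  funext v w
  refine propext ⟨h v w, fun h' => ?_⟩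
  rcases T.total (hV ▸ T'.left_mem h') (hV ▸ T'.right_mem h')
    (by rintro rfl; exact T'.irrefl _ h') with h1 | h1
  · exact h1
  · exact absurd (h _ _ h1) (T'.asymm h')

theorem quotient_arc {P : Set (Set α)} {hne : ∀ X ∈ P, X.Nonempty}
    {hdisj : ∀ X ∈ P, ∀ Y ∈ P, ∀ v, v ∈ X → v ∈ Y → X = Y} {hmod : ∀ X ∈ P, T.IsModule X}
    {X Y : Set α} (h : (T.quotient P hne hdisj hmod).Arc X Y) {a b : α} (ha : a ∈ X)
    (hb : b ∈ Y) : T.Arc a b := by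
  obtain ⟨hX, hY, hXY, a', ha', b', hb', h⟩ := h
  have h1 := (hmod X hX).arc_left (fun h => hXY (hdisj X hX Y hY b' h hb')) ha' ha h
  exact (hmod Y hY).2 a b' b (fun h => hXY (hdisj X hX Y hY a ha h)) hb' hb h1

theorem quotient_mem_realizations (hu : H.IsUniformOfSize 3) (hfin : H.vertexSet.Finite)
    (hV : H.vertexSet.Nontrivial) (hT : T ∈ H.realizations)
    {hne : ∀ X ∈ H.maxStrongModules, X.Nonempty}
    {hdisj : ∀ X ∈ H.maxStrongModules, ∀ Y ∈ H.maxStrongModules, ∀ v, v ∈ X → v ∈ Y → X = Y}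
    {hmod : ∀ X ∈ H.maxStrongModules, T.IsModule X} :
    T.quotient H.maxStrongModules hne hdisj hmod ∈ H.quotient.realizations := by
  have hE := ((mem_realizations_iff hu).1 hT).2
  refine (mem_realizations_iff (Hypergraph.quotient_isUniformOfSize hu hfin hV)).2
    ⟨rfl, fun X Y Z => ⟨fun h => ?_, fun h => ?_⟩⟩
  · obtain ⟨⟨hX, hY, hZ⟩, ⟨hXY, hYZ, hXZ⟩, a, ha, b, hb, c, hc, h⟩ :=
      (Hypergraph.quotient_adj3_iff hu hfin hV).1 h
    rcases (hE a b c).1 h with ⟨h1, h2, h3⟩ | ⟨h1, h2, h3⟩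
    · exact Or.inl ⟨⟨hX, hY, hXY, a, ha, b, hb, h1⟩, ⟨hY, hZ, hYZ, b, hb, c, hc, h2⟩,
        ⟨hZ, hX, hXZ.symm, c, hc, a, ha, h3⟩⟩
    · exact Or.inr ⟨⟨hY, hX, hXY.symm, b, hb, a, ha, h1⟩, ⟨hZ, hY, hYZ.symm, c, hc, b, hb, h2⟩,
        ⟨hX, hZ, hXZ, a, ha, c, hc, h3⟩⟩
  · have hX : X ∈ H.maxStrongModules := h.left_mem
    have hY : Y ∈ H.maxStrongModules := h.rotate.left_mem
    have hZ : Z ∈ H.maxStrongModules := h.rotate.rotate.left_mem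
    obtain ⟨a, ha⟩ := hne X hX
    obtain ⟨b, hb⟩ := hne Y hY
    obtain ⟨c, hc⟩ := hne Z hZ
    refine (Hypergraph.quotient_adj3_iff hu hfin hV).2 ⟨⟨hX, hY, hZ⟩,
      ⟨h.ne, h.rotate.ne, h.rotate.rotate.ne.symm⟩, a, ha, b, hb, c, hc, (hE a b c).2 ?_⟩
    exact h.imp
      (fun h => ⟨quotient_arc h.1 ha hb, quotient_arc h.2.1 hb hc, quotient_arc h.2.2 hc ha⟩)
      (fun h => ⟨quotient_arc h.1 hb ha, quotient_arc h.2.1 hc hb, quotient_arc h.2.2 ha hc⟩)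

section LexSum

variable {V : Set α} {P : Set (Set α)} {hcov : ∀ v ∈ V, ∃ X ∈ P, v ∈ X} {hsub : ∀ X ∈ P, X ⊆ V}
  {hdisj : ∀ X ∈ P, ∀ Y ∈ P, ∀ v, v ∈ X → v ∈ Y → X = Y} {Q : Tournament (Set α)}
  {hQ : Q.vertexSet = P} {S : P → Tournament α} {hS : ∀ X : P, (S X).vertexSet = X}

theorem lexSum_arc_iff_of_mem {X : P} {v w : α} (hv : v ∈ X.1) (hw : w ∈ X.1) :
    (lexSum V P hcov hsub hdisj Q hQ S hS).Arc v w ↔ (S X).Arc v w := by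
  refine ⟨?_, fun h => Or.inl ⟨X, h⟩⟩
  rintro (⟨Y, h⟩ | ⟨Y, Z, h, hv', hw'⟩)
  · obtain rfl : X = Y :=
      Subtype.ext (hdisj X X.2 Y Y.2 v hv (hS Y ▸ (S Y).left_mem h))
    exact h
  · have h1 := hdisj X X.2 Y (hQ ▸ Q.left_mem h) v hv hv'
    have h2 := hdisj X X.2 Z (hQ ▸ Q.right_mem h) w hw hw'
    rw [← h1, ← h2] at h
    exact absurd h (Q.irrefl _)

theorem lexSum_arc_iff_of_ne {X Y : Set α} (hX : X ∈ P) (hY : Y ∈ P) (hXY : X ≠ Y) {v w : α}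
    (hv : v ∈ X) (hw : w ∈ Y) :
    (lexSum V P hcov hsub hdisj Q hQ S hS).Arc v w ↔ Q.Arc X Y := by
  refine ⟨?_, fun h => Or.inr ⟨X, Y, h, hv, hw⟩⟩
  rintro (⟨Z, h⟩ | ⟨Z, W, h, hv', hw'⟩)
  · have h1 := hdisj X hX Z Z.2 v hv (hS Z ▸ (S Z).left_mem h)
    have h2 := hdisj Y hY Z Z.2 w hw (hS Z ▸ (S Z).right_mem h)
    exact absurd (h1.trans h2.symm) hXY
  · rwa [hdisj X hX Z (hQ ▸ Q.left_mem h) v hv hv', hdisj Y hY W (hQ ▸ Q.right_mem h) w hw hw']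

end LexSum

/-- A 3-cycle of the substituted tournament never meets exactly two blocks (`cycN`), since the two
vertices sharing a block look alike from the other one. The remaining 3-cycles lie in one block,
governed by `S`, or are transversal to three, governed by `Q`; edges of `H` split in the same way.
-/
theorem lexSum_mem_realizations (hu : H.IsUniformOfSize 3) (hfin : H.vertexSet.Finite)
    (hV : H.vertexSet.Nontrivial)
    {hcov : ∀ v ∈ H.vertexSet, ∃ X ∈ H.maxStrongModules, v ∈ X}
    {hsub : ∀ X ∈ H.maxStrongModules, X ⊆ H.vertexSet}
    {hdisj : ∀ X ∈ H.maxStrongModules, ∀ Y ∈ H.maxStrongModules, ∀ v, v ∈ X → v ∈ Y → X = Y}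
    {Q : Tournament (Set α)} {hQ : Q.vertexSet = H.maxStrongModules}
    {S : H.maxStrongModules → Tournament α} {hS : ∀ X : H.maxStrongModules, (S X).vertexSet = X}
    (hQR : Q ∈ H.quotient.realizations)
    (hSR : ∀ X : H.maxStrongModules, S X ∈ (H.inducedOn X).realizations) :
    lexSum H.vertexSet H.maxStrongModules hcov hsub hdisj Q hQ S hS ∈ H.realizations := by
  have hQE := ((mem_realizations_iff (Hypergraph.quotient_isUniformOfSize hu hfin hV)).1 hQR).2
  have hSE := fun X : H.maxStrongModules => ((mem_realizations_iff (hu.inducedOn _)).1 (hSR X)).2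
  refine (mem_realizations_iff hu).2 ⟨rfl, ?_⟩
  set L := lexSum H.vertexSet H.maxStrongModules hcov hsub hdisj Q hQ S hS with hL
  have cycS : ∀ (X : H.maxStrongModules) (a b c : α), a ∈ X.1 → b ∈ X.1 → c ∈ X.1 →
      (L.Cyc a b c ↔ (S X).Cyc a b c) := by
    intro X a b c ha hb hc
    simp only [Cyc, hL, lexSum_arc_iff_of_mem ha hb, lexSum_arc_iff_of_mem hb hc,
      lexSum_arc_iff_of_mem hc ha, lexSum_arc_iff_of_mem hb ha, lexSum_arc_iff_of_mem hc hb,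
      lexSum_arc_iff_of_mem ha hc]
  have cycQ : ∀ (X Y Z : Set α), X ∈ H.maxStrongModules → Y ∈ H.maxStrongModules →
      Z ∈ H.maxStrongModules → X ≠ Y → Y ≠ Z → X ≠ Z → ∀ a ∈ X, ∀ b ∈ Y, ∀ c ∈ Z,
      (L.Cyc a b c ↔ Q.Cyc X Y Z) := by
    intro X Y Z hX hY hZ hXY hYZ hXZ a ha b hb c hc
    simp only [Cyc, hL, lexSum_arc_iff_of_ne hX hY hXY ha hb,
      lexSum_arc_iff_of_ne hY hX hXY.symm hb ha, lexSum_arc_iff_of_ne hY hZ hYZ hb hc,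
      lexSum_arc_iff_of_ne hZ hY hYZ.symm hc hb, lexSum_arc_iff_of_ne hX hZ hXZ ha hc,
      lexSum_arc_iff_of_ne hZ hX hXZ.symm hc ha]
  have cycN : ∀ (X Z : Set α), X ∈ H.maxStrongModules → Z ∈ H.maxStrongModules → X ≠ Z →
      ∀ a ∈ X, ∀ b ∈ X, ∀ c ∈ Z, ¬ L.Cyc a b c := by
    intro X Z hX hZ hXZ a ha b hb c hc
    simp only [Cyc, hL, lexSum_arc_iff_of_ne hX hZ hXZ ha hc,
      lexSum_arc_iff_of_ne hZ hX hXZ.symm hc ha, lexSum_arc_iff_of_ne hX hZ hXZ hb hc,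
      lexSum_arc_iff_of_ne hZ hX hXZ.symm hc hb]
    have := @Q.asymm X Z
    tauto
  intro a b c
  constructor
  · intro h
    obtain ⟨X, hX, ha⟩ := hcov a h.mem
    obtain ⟨Y, hY, hb⟩ := hcov b h.rotate.mem
    obtain ⟨Z, hZ, hc⟩ := hcov c h.rotate.rotate.mem
    by_cases hXZ : X = Z
    · subst hXZ
      by_cases hXY : X = Y
      · subst hXY
        exact (cycS ⟨X, hX⟩ a b c ha hb hc).2
          ((hSE ⟨X, hX⟩ a b c).1 (Hypergraph.inducedOn_adj3.2 ⟨h, ha, hb, hc⟩))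
      · exact absurd rfl (h.swap.rotate.ne_of_ne hu hX hY ha hc hb hXY).1
    · obtain ⟨hXY, hYZ⟩ := h.ne_of_ne hu hX hZ ha hb hc hXZ
      exact (cycQ X Y Z hX hY hZ hXY hYZ hXZ a ha b hb c hc).2 ((hQE X Y Z).1
        ((Hypergraph.quotient_adj3_iff hu hfin hV).2
          ⟨⟨hX, hY, hZ⟩, ⟨hXY, hYZ, hXZ⟩, a, ha, b, hb, c, hc, h⟩))
  · intro h
    obtain ⟨X, hX, ha⟩ := hcov a h.left_mem
    obtain ⟨Y, hY, hb⟩ := hcov b h.rotate.left_mem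
    obtain ⟨Z, hZ, hc⟩ := hcov c h.rotate.rotate.left_mem
    by_cases hXY : X = Y
    · subst hXY
      by_cases hXZ : X = Z
      · subst hXZ
        exact (Hypergraph.inducedOn_adj3.1
          ((hSE ⟨X, hX⟩ a b c).2 ((cycS ⟨X, hX⟩ a b c ha hb hc).1 h))).1
      · exact absurd h (cycN X Z hX hZ hXZ a ha b hb c hc)
    · by_cases hYZ : Y = Z
      · subst hYZ
        exact absurd h.rotate (cycN Y X hY hX (Ne.symm hXY) b hb c hc a ha)
      · by_cases hXZ : X = Z
        · subst hXZ
          exact absurd h.rotate.rotate (cycN X Y hX hY hXY c hc a ha b hb)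
        · obtain ⟨-, -, a', ha', b', hb', c', hc', h'⟩ :=
            (Hypergraph.quotient_adj3_iff hu hfin hV).1
              ((hQE X Y Z).2 ((cycQ X Y Z hX hY hZ hXY hYZ hXZ a ha b hb c hc).1 h))
          exact h'.transversal hu hX hY hZ ha' hb' hc' hXY hYZ hXZ ha hb hc

/-- A realization of `H` amounts to a realization of `H/Π(H)` together with a realization of
`H[X]` for each `X ∈ Π(H)`. -/
theorem ncard_realizations_eq_mul_finprod (hu : H.IsUniformOfSize 3) (hfin : H.vertexSet.Finite)
    (hV : H.vertexSet.Nontrivial) :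
    H.realizations.ncard = H.quotient.realizations.ncard *
      ∏ᶠ X ∈ H.maxStrongModules, (H.inducedOn X).realizations.ncard := by
  have hne : ∀ X ∈ H.maxStrongModules, X.Nonempty := fun X hX =>
    Hypergraph.nonempty_of_mem_maxStrongModules hu hfin hV hX
  have hdisj : ∀ X ∈ H.maxStrongModules, ∀ Y ∈ H.maxStrongModules, ∀ v, v ∈ X → v ∈ Y → X = Y :=
    fun X hX Y hY v => Hypergraph.eq_of_mem_maxStrongModules hX hY
  have hsub : ∀ X ∈ H.maxStrongModules, X ⊆ H.vertexSet := fun X hX =>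
    Hypergraph.subset_of_mem_maxStrongModules hX
  have hcov : ∀ v ∈ H.vertexSet, ∃ X ∈ H.maxStrongModules, v ∈ X := fun v hv =>
    Hypergraph.exists_mem_maxStrongModules_mem hu hfin hV hv
  have hmod : ∀ T ∈ H.realizations, ∀ X ∈ H.maxStrongModules, T.IsModule X := fun T hT X hX =>
    (Hypergraph.isStrongModule_of_mem_maxStrongModules hX).isModule hu hT
  -- The quotient of `T` makes sense because strong modules of `H` are modules of `T`. Surjectivity
  -- comes from `lexSum`.
  let f : H.realizations →
      H.quotient.realizations × ∀ X : H.maxStrongModules, (H.inducedOn X).realizations :=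
    fun T => ⟨⟨T.1.quotient H.maxStrongModules hne hdisj (hmod T.1 T.2),
      quotient_mem_realizations hu hfin hV T.2⟩,
      fun X => ⟨T.1.inducedOn X, inducedOn_mem_realizations hu T.2 (hsub X X.2)⟩⟩
  have hf : Function.Bijective f := by
    constructor
    · rintro ⟨T, hT⟩ ⟨T', hT'⟩ h
      have h1 : T.quotient H.maxStrongModules hne hdisj (hmod T hT) =
          T'.quotient H.maxStrongModules hne hdisj (hmod T' hT') :=
        congrArg (fun p => (p.1 : Tournament (Set α))) h
      have h2 : ∀ X : H.maxStrongModules, T.inducedOn X = T'.inducedOn X := fun X =>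
        congrArg (fun p => (p.2 X : Tournament α)) h
      refine Subtype.ext (eq_of_arc_imp (hT.1.trans hT'.1.symm) fun v w hvw => ?_)
      obtain ⟨X, hX, hv⟩ := hcov v (hT.1 ▸ T.left_mem hvw)
      obtain ⟨Y, hY, hw⟩ := hcov w (hT.1 ▸ T.right_mem hvw)
      by_cases hXY : X = Y
      · subst hXY
        have h3 : (T.inducedOn X).Arc v w := ⟨hvw, hv, hw⟩
        rw [h2 ⟨X, hX⟩] at h3
        exact h3.1
      · have h3 : (T.quotient H.maxStrongModules hne hdisj (hmod T hT)).Arc X Y :=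
          ⟨hX, hY, hXY, v, hv, w, hw, hvw⟩
        rw [h1] at h3
        exact quotient_arc h3 hv hw
    · rintro ⟨⟨Q, hQ⟩, S⟩
      have hS : ∀ X : H.maxStrongModules, ((S X).1).vertexSet = X := fun X => (S X).2.1
      have hL := lexSum_mem_realizations (hcov := hcov) (hsub := hsub) (hdisj := hdisj)
        (hQ := hQ.1) (hS := hS) hu hfin hV hQ (fun X => (S X).2)
      refine ⟨⟨_, hL⟩, Prod.ext (Subtype.ext (eq_of_arc_imp hQ.1.symm ?_))
        (funext fun X => Subtype.ext (eq_of_arc_imp ?_ ?_))⟩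
      · rintro X Y ⟨hX, hY, hXY, a, ha, b, hb, h⟩
        exact (lexSum_arc_iff_of_ne (hcov := hcov) (hsub := hsub) (hdisj := hdisj)
          (hQ := hQ.1) (hS := hS) hX hY hXY ha hb).1 h
      · rw [hS X]
        exact Set.inter_eq_right.2 (hsub X X.2)
      · rintro v w ⟨h, hv, hw⟩
        exact (lexSum_arc_iff_of_mem (hcov := hcov) (hsub := hsub) (hdisj := hdisj)
          (hQ := hQ.1) (hS := hS) hv hw).1 h
  have := (Hypergraph.finite_maxStrongModules hfin).fintype
  rw [← Nat.card_coe_set_eq, Nat.card_congr (Equiv.ofBijective f hf), Nat.card_prod, Nat.card_pi,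
    Nat.card_coe_set_eq, ← finprod_set_coe_eq_finprod_mem, finprod_eq_prod_of_fintype]
  rfl

end Decomposition

end Tournament

/-! ### Induction on the number of vertices -/

namespace Hypergraph

section Main

variable {α : Type*} {H : Hypergraph α}

theorem strongModulesGeTwo_finite (hfin : H.vertexSet.Finite) : H.strongModulesGeTwo.Finite :=
  hfin.finite_subsets.subset fun _ hX => hX.1.1.1

theorem strongModulesGeTwo_inducedOn (hu : H.IsUniformOfSize 3) {X : Set α}
    (hX : H.IsStrongModule X) :
    (H.inducedOn X).strongModulesGeTwo = {Y ∈ H.strongModulesGeTwo | Y ⊆ X} := by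
  ext Y
  refine ⟨fun h => ?_, fun h => ?_⟩
  · obtain ⟨h1, h2⟩ := (isStrongModule_inducedOn_iff hu hX).1 h.1
    exact ⟨⟨h1, h.2⟩, h2⟩
  · exact ⟨(isStrongModule_inducedOn_iff hu hX).2 ⟨h.1.1, h.2⟩, h.1.2⟩

/-- The strong modules with at least two elements, other than `V(H)`, are those of the `H[X]`,
`X ∈ Π(H)`. -/
theorem strongModulesGeTwo_eq_insert (hu : H.IsUniformOfSize 3) (hfin : H.vertexSet.Finite)
    (hV : H.vertexSet.Nontrivial) :
    H.strongModulesGeTwo = insert H.vertexSet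
      (⋃ X ∈ H.maxStrongModules, (H.inducedOn X).strongModulesGeTwo) := by
  ext Y
  simp only [Set.mem_insert_iff, Set.mem_iUnion, exists_prop]
  constructor
  · intro hY
    by_cases hYV : Y = H.vertexSet
    · exact Or.inl hYV
    · obtain ⟨X, hX, hYX⟩ := exists_mem_maxStrongModules hfin hY.1 hYV
      refine Or.inr ⟨X, hX, ?_⟩
      rw [strongModulesGeTwo_inducedOn hu (isStrongModule_of_mem_maxStrongModules hX)]
      exact ⟨hY, hYX⟩
  · rintro (rfl | ⟨X, hX, hY⟩)
    · refine ⟨isStrongModule_vertexSet, ?_⟩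
      have := Set.one_lt_encard_iff_nontrivial.2 hV
      exact Order.add_one_le_of_lt this
    · rw [strongModulesGeTwo_inducedOn hu (isStrongModule_of_mem_maxStrongModules hX)] at hY
      exact hY.1

open Classical in
/-- The number of realizations of `H[X]/Π(H[X])`. -/
noncomputable def nodeWeight (H : Hypergraph α) (X : Set α) : ℕ :=
  (if (H.gallaiQuotient X).IsPrimeHypergraph then 2 else 1) *
    (if (H.gallaiQuotient X).HasNoEdge then (H.inducedOn X).maxStrongModules.ncard.factorial else 1)

theorem nodeWeight_inducedOn {X Y : Set α} (h : Y ⊆ X) :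
    (H.inducedOn X).nodeWeight Y = H.nodeWeight Y := by
  unfold nodeWeight gallaiQuotient
  rw [inducedOn_inducedOn h]

/-- Exactly one factor of `nodeWeight` is active, since a prime hypergraph has an edge and the
quotient is empty or prime. Realizability is needed for the value 2. -/
theorem nodeWeight_vertexSet (hu : H.IsUniformOfSize 3) (hfin : H.vertexSet.Finite)
    (hV : H.vertexSet.Nontrivial) (hreal : H.quotient.IsRealizable) :
    H.nodeWeight H.vertexSet = H.quotient.realizations.ncard := by
  have hK := quotient_isUniformOfSize hu hfin hV
  have hq : H.gallaiQuotient H.vertexSet = H.quotient := by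
    unfold gallaiQuotient quotient
    rw [inducedOn_vertexSet]
  unfold nodeWeight
  rw [hq, inducedOn_vertexSet]
  rcases quotient_hasNoEdge_or_isPrimeHypergraph hu hfin hV with h | h
  · rw [if_neg fun h' => h'.not_hasNoEdge hK h, if_pos h, one_mul,
      Tournament.ncard_realizations_of_hasNoEdge hK (finite_maxStrongModules hfin) h]
    rfl
  · rw [if_pos h, if_neg (h.not_hasNoEdge hK), mul_one,
      Tournament.ncard_realizations_of_isPrimeHypergraph hK h hreal]

theorem ncard_realizations_of_subsingleton (hV : H.vertexSet.Subsingleton)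
    (hreal : H.IsRealizable) : H.realizations.ncard = 1 := by
  obtain ⟨T, hT⟩ := hreal
  refine Set.ncard_eq_one.2 ⟨T, Set.eq_singleton_iff_unique_mem.2 ⟨hT, fun T' hT' =>
    Tournament.eq_of_arc_imp (hT'.1.trans hT.1.symm) fun v w h => ?_⟩⟩
  have : v = w := hV (hT'.1 ▸ T'.left_mem h) (hT'.1 ▸ T'.right_mem h)
  exact absurd (this ▸ h) (T'.irrefl _)

theorem ncard_realizations_eq_finprod (hfin : H.vertexSet.Finite) (hu : H.IsUniformOfSize 3)
    (hreal : H.IsRealizable) :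
    H.realizations.ncard = ∏ᶠ X ∈ H.strongModulesGeTwo, H.nodeWeight X := by
  induction hn : H.vertexSet.ncard using Nat.strong_induction_on generalizing H with
  | _ n ih =>
  subst hn
  by_cases hV : H.vertexSet.Subsingleton
  · have : H.strongModulesGeTwo = ∅ := by
      refine Set.eq_empty_iff_forall_notMem.2 fun X hX => ?_
      have h1 := Set.encard_le_one_iff_subsingleton.2 (hV.anti hX.1.1.1)
      have := hX.2.trans h1
      norm_num at this
    rw [this, finprod_mem_empty, ncard_realizations_of_subsingleton hV hreal]
  · rw [Set.not_subsingleton_iff] at hV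
    obtain ⟨T, hT⟩ := hreal
    have hsub : ∀ X ∈ H.maxStrongModules, X ⊆ H.vertexSet :=
      fun X hX => subset_of_mem_maxStrongModules hX
    have hKreal : H.quotient.IsRealizable :=
      ⟨_, Tournament.quotient_mem_realizations hu hfin hV hT
        (hne := fun X hX => nonempty_of_mem_maxStrongModules hu hfin hV hX)
        (hdisj := fun X hX Y hY v => eq_of_mem_maxStrongModules hX hY)
        (hmod := fun X hX => (isStrongModule_of_mem_maxStrongModules hX).isModule hu hT)⟩
    have hfin' : ∀ X ∈ H.maxStrongModules, (H.inducedOn X).strongModulesGeTwo.Finite :=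
      fun X hX => strongModulesGeTwo_finite (hfin.subset (hsub X hX))
    have hmem : ∀ X ∈ H.maxStrongModules, ∀ Y ∈ (H.inducedOn X).strongModulesGeTwo, Y ⊆ X :=
      fun X _ Y hY => hY.1.1.1
    have hP := finite_maxStrongModules hfin
    have hdisj : H.maxStrongModules.PairwiseDisjoint
        fun X => (H.inducedOn X).strongModulesGeTwo := by
      intro X hX Y hY hXY
      refine Set.disjoint_left.2 fun Z hZX hZY => hXY ?_
      obtain ⟨z, hz⟩ : Z.Nonempty := by
        rw [← Set.encard_pos]
        exact lt_of_lt_of_le (by norm_num) hZX.2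
      exact eq_of_mem_maxStrongModules hX hY (hmem X hX Z hZX hz) (hmem Y hY Z hZY hz)
    -- The node `H.vertexSet` contributes the realizations of the quotient. The other nodes are
    -- grouped by the block containing them; the groups are disjoint because nodes are nonempty, and
    -- induction evaluates each.
    rw [strongModulesGeTwo_eq_insert hu hfin hV, finprod_mem_insert _ ?_ (hP.biUnion hfin'),
      nodeWeight_vertexSet hu hfin hV hKreal,
      Tournament.ncard_realizations_eq_mul_finprod hu hfin hV,
      finprod_mem_biUnion hdisj hP hfin']
    · congr 1
      refine finprod_mem_congr rfl fun X hX => ?_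
      rw [ih _ ?_ (hfin.subset (hsub X hX)) (hu.inducedOn X)
        ⟨_, Tournament.inducedOn_mem_realizations hu hT (hsub X hX)⟩ rfl]
      · exact finprod_mem_congr rfl fun Y hY => nodeWeight_inducedOn (hmem X hX Y hY)
      · exact Set.ncard_lt_ncard ((hsub X hX).ssubset_of_ne (ne_of_mem_maxStrongModules hX)) hfin
    · simp only [Set.mem_iUnion, not_exists]
      intro X hX h
      exact ne_of_mem_maxStrongModules hX ((hsub X hX).antisymm (hmem X hX _ h))

theorem finprod_nodeWeight (hfin : H.vertexSet.Finite) :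
    ∏ᶠ X ∈ H.strongModulesGeTwo, H.nodeWeight X =
      2 ^ H.primeNodes.ncard *
        ∏ᶠ X ∈ H.emptyNodes, (H.inducedOn X).maxStrongModules.ncard.factorial := by
  classical
  have hD := strongModulesGeTwo_finite hfin
  have hp : H.primeNodes = ↑(hD.toFinset.filter fun X =>
      (H.gallaiQuotient X).IsPrimeHypergraph) := by
    ext X; simp [primeNodes]
  have he : H.emptyNodes = ↑(hD.toFinset.filter fun X => (H.gallaiQuotient X).HasNoEdge) := by
    ext X; simp [emptyNodes]
  rw [finprod_mem_eq_finite_toFinset_prod _ hD, he, finprod_mem_coe_finset, hp,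
    Set.ncard_coe_finset, Finset.prod_filter, ← Finset.prod_const, Finset.prod_filter,
    ← Finset.prod_mul_distrib]
  rfl

end Main

end Hypergraph

theorem mainTheorem6 {α : Type*} (H : Hypergraph α) (hfin : H.vertexSet.Finite)
    (hunif : H.IsUniformOfSize 3) (hreal : H.IsRealizable) :
    H.realizations.ncard =
      2 ^ H.primeNodes.ncard *
        ∏ᶠ X ∈ H.emptyNodes, (H.inducedOn X).maxStrongModules.ncard.factorial := by
  rw [Hypergraph.ncard_realizations_eq_finprod hfin hunif hreal,
    Hypergraph.finprod_nodeWeight hfin]
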